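/- Let $I=[0,1]$ with Lebesgue measure $m$, and let $C^0(I,I)$ be the space of continuous maps $f\colon I\to I$ with the topology of uniform convergence. Let $\mathcal M$ be the space of Borel probability measures on $I$ with the weak$^*$ topology, and $\mathcal M_f\subset\mathcal M$ the subspace of $f$-invariant ones. For $f\in C^0(I,I)$ and $\epsilon>0$ let $B_\epsilon(y)=\{z\in I:|z-y|<\epsilon\}$ and $$p_\epsilon(x,A)=\frac{m(A\cap B_\epsilon(f(x)))}{m(B_\epsilon(f(x)))}$$ for Borel $A\subset I$. Let $\mathcal L_\epsilon^*\colon\mathcal M\to\mathcal M$, $(\mathcal L_\epsilon^*\mu)(A)=\int p_\epsilon(x,A)\,d\mu(x)$, be the dual transfer operator (equivalently, $\int\varphi\,d(\mathcal L^*_\epsilon\mu)=\int\!\int\varphi(y)\,p_\epsilon(x,dy)\,d\mu(x)$ for all continuous $\varphi$). For $n\ge1$ and $x\in I$ put $\sigma_{\epsilon,n,x}=\frac1n\sum_{j=1}^n(\mathcal L_\epsilon^*)^j\delta_x$. Let $\mathrm{dist}^*$ be any metric on $\mathcal M$ inducing the weak$^*$ topology, and $\mathrm{dist}^*(\mu,\mathcal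 K)=\inf_{\nu\in\mathcal K}\mathrm{dist}^*(\mu,\nu)$. For a nonempty weak$^*$-compact set $\mathcal K\subset\mathcal M_f$, the basin $\widehat A_{\mathcal K}$ is the set of $x\in I$ such that for every $\rho>0$ there is $N$ such that for every $n\ge N$ there is $\epsilon_0>0$ with $\mathrm{dist}^*(\sigma_{\epsilon,n,x},\mathcal K)<\rho$ for all $0<\epsilon\le\epsilon_0$. The set $\mathcal K$ is *empirically stochastically stable* if (a) there is a measurable set $\widehat A\subset I$ with $m(\widehat A)>0$ such that for every $\rho>0$ and every sufficiently large $n$ there is $\epsilon_0>0$ (independent of $x$) with $\mathrm{dist}^*(\sigma_{\epsilon,n,x},\mathcal K)<\rho$ for all $0<\epsilon\le\epsilon_0$ and all $x\in\widehat A$; and (b) whenever $\mathcal K'\subset\mathcal M_f$ is nonempty and weak$^*$-compact and $\widehat A_{\mathcal K}\subset\widehat A_{\mathcal K'}$ up to a Lebesgue-null set, then $\mathcal K\subset\mathcal K'$. It is *globally* empirically stochastically stable if, in addition, $\widehat A_{\mathcal K}$ has full Lebesgue measure. **Corollary.** There is a residual subset of $C^0(I,I)$ such that, for every $f$ in it and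 every choice of the metric $\mathrm{dist}^*$, there is exactly one globally empirically stochastically stable set $\mathcal K\subset\mathcal M_f$; this $\mathcal K$ contains every ergodic $f$-invariant Borel probability measure, but it is closed with empty interior in $\mathcal M_f$; in particular it is meager in $\mathcal M_f$. -/

import Mathlib

open MeasureTheory ProbabilityTheory Set Filter Topology
open scoped ENNReal unitInterval

noncomputable section

namespace EmpiricStability

section General

/-! `M` is a compact metric space whose reference measure `volume` (the Lebesgue measure) is finite
and positive on nonempty open sets. -/

variable {M : Type*} [MetricSpace M] [CompactSpace M] [MeasureSpace M] [BorelSpace M]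
  [IsFiniteMeasure (volume : Measure M)]

/-- The transition probabilities `p_ε(x, A) = m (A ∩ B_ε(f x)) / m (B_ε(f x))`. -/
def transitionKernel (f : C(M, M)) (ε : ℝ) : Kernel M M where
  toFun x := (volume : Measure M)[|Metric.ball (f x) ε]
  measurable' := by
    have hS : MeasurableSet {q : M × M | dist q.2 (f q.1) < ε} :=
      (isOpen_lt (continuous_snd.dist (f.continuous.comp continuous_fst))
        continuous_const).measurableSet
    refine Measure.measurable_of_measurable_coe _ fun A hA => ?_
    have h1 : Measurable fun x : M => volume (Metric.ball (f x) ε) :=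
      measurable_measure_prodMk_left hS
    have h2 : Measurable fun x : M => volume (Metric.ball (f x) ε ∩ A) :=
      measurable_measure_prodMk_left (hS.inter (measurable_snd hA))
    simp only [cond_apply Metric.isOpen_ball.measurableSet]
    exact h1.inv.mul h2

/-- The transfer operator on observables, `(L_ε φ)(x) = ∫ φ(y) p_ε(x, dy)`. -/
def transferOperator (f : C(M, M)) (ε : ℝ) (φ : M → ℂ) (x : M) : ℂ :=
  ∫ y, φ y ∂(transitionKernel f ε x)

/-- The dual transfer operator on measures, `(L_ε^* μ)(A) = ∫ p_ε(x, A) dμ(x)`. -/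
def transferDual (f : C(M, M)) (ε : ℝ) (μ : Measure M) : Measure M :=
  μ.bind (transitionKernel f ε)

variable [(volume : Measure M).IsOpenPosMeasure]

lemma isMarkovKernel_transitionKernel (f : C(M, M)) {ε : ℝ} (hε : 0 < ε) :
    IsMarkovKernel (transitionKernel f ε) :=
  ⟨fun x => cond_isProbabilityMeasure (Metric.measure_ball_pos volume (f x) hε).ne'⟩

lemma isProbabilityMeasure_transferDual (f : C(M, M)) {ε : ℝ} (hε : 0 < ε) (μ : Measure M)
    [IsProbabilityMeasure μ] : IsProbabilityMeasure (transferDual f ε μ) := by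
  have := isMarkovKernel_transitionKernel f hε
  unfold transferDual
  infer_instance

/-- The duality that characterizes `L_ε^*`. -/
lemma integral_transferDual (f : C(M, M)) {ε : ℝ} (hε : 0 < ε) (μ : Measure M)
    [IsProbabilityMeasure μ] (φ : C(M, ℂ)) :
    ∫ y, φ y ∂(transferDual f ε μ) = ∫ x, transferOperator f ε φ x ∂μ := by
  have := isMarkovKernel_transitionKernel f hε
  have := isProbabilityMeasure_transferDual f hε μ
  have hφ : Integrable φ (transferDual f ε μ) :=
    (BoundedContinuousFunction.mkOfCompact φ).integrable (transferDual f ε μ)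
  exact Kernel.integral_comp (κ := Kernel.const Unit μ) (η := transitionKernel f ε) (a := ()) hφ

lemma isProbabilityMeasure_iterate (f : C(M, M)) {ε : ℝ} (hε : 0 < ε) (x : M) (j : ℕ) :
    IsProbabilityMeasure ((transferDual f ε)^[j] (Measure.dirac x)) := by
  induction j with
  | zero => simpa using (inferInstance : IsProbabilityMeasure (Measure.dirac x))
  | succ j ih =>
    rw [Function.iterate_succ_apply']
    exact isProbabilityMeasure_transferDual f hε _

/-- The empiric stochastic probability `σ_{ε,n,x} = (1/n) ∑_{j=1}^n (L_ε^*)^j δ_x`. -/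
def empiricStochastic (f : C(M, M)) {ε : ℝ} (hε : 0 < ε) (n : ℕ+) (x : M) :
    ProbabilityMeasure M :=
  ⟨((n : ℕ) : ℝ≥0∞)⁻¹ • ∑ j ∈ Finset.Icc 1 (n : ℕ), (transferDual f ε)^[j] (Measure.dirac x), by
    constructor
    have h (j : ℕ) : (transferDual f ε)^[j] (Measure.dirac x) univ = 1 :=
      (isProbabilityMeasure_iterate f hε x j).measure_univ
    simp only [Measure.smul_apply, Measure.finsetSum_apply, h, Finset.sum_const, Nat.card_Icc,
      Nat.add_sub_cancel, nsmul_eq_mul, mul_one, smul_eq_mul]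
    exact ENNReal.inv_mul_cancel (by exact_mod_cast n.ne_zero) (ENNReal.natCast_ne_top _)⟩

/-- The set `M_f` of `f`-invariant Borel probability measures. -/
def invariantMeasures (f : C(M, M)) : Set (ProbabilityMeasure M) :=
  {μ | MeasurePreserving f (μ : Measure M) (μ : Measure M)}

/-- `d` is a metric on the space of Borel probability measures that induces the weak* topology. -/
def IsWeakStarMetric (d : ProbabilityMeasure M → ProbabilityMeasure M → ℝ) : Prop :=
  ∃ D : MetricSpace (ProbabilityMeasure M),
    (∀ μ ν, D.dist μ ν = d μ ν) ∧
    D.toUniformSpace.toTopologicalSpace =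
      (inferInstance : TopologicalSpace (ProbabilityMeasure M))

/-- The distance from a measure to a (nonempty) set of measures. -/
def distToSet (d : ProbabilityMeasure M → ProbabilityMeasure M → ℝ) (μ : ProbabilityMeasure M)
    (K : Set (ProbabilityMeasure M)) : ℝ :=
  sInf (d μ '' K)

/-- The basin of empiric stochastic stability of a set `K` of measures. -/
def stochasticBasin (d : ProbabilityMeasure M → ProbabilityMeasure M → ℝ) (f : C(M, M))
    (K : Set (ProbabilityMeasure M)) : Set M :=
  {x | ∀ ρ : ℝ, 0 < ρ → ∃ N : ℕ+, ∀ n : ℕ+, N ≤ n → ∃ ε₀ : ℝ, 0 < ε₀ ∧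
    ∀ (ε : ℝ) (hε : 0 < ε), ε ≤ ε₀ → distToSet d (empiricStochastic f hε n x) K < ρ}

/-- Empiric stochastic stability of a nonempty weak*-compact set of invariant measures. -/
structure IsEmpiricallyStable (d : ProbabilityMeasure M → ProbabilityMeasure M → ℝ) (f : C(M, M))
    (K : Set (ProbabilityMeasure M)) : Prop where
  nonempty : K.Nonempty
  isCompact : IsCompact K
  subset_invariant : K ⊆ invariantMeasures f
  approximates : ∃ A : Set M, MeasurableSet A ∧ 0 < volume A ∧
    ∀ ρ : ℝ, 0 < ρ → ∃ N : ℕ+, ∀ n : ℕ+, N ≤ n → ∃ ε₀ : ℝ, 0 < ε₀ ∧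
      ∀ (ε : ℝ) (hε : 0 < ε), ε ≤ ε₀ → ∀ x ∈ A,
        distToSet d (empiricStochastic f hε n x) K < ρ
  minimal : ∀ K' : Set (ProbabilityMeasure M), K'.Nonempty → IsCompact K' →
    K' ⊆ invariantMeasures f →
    (∀ᵐ x ∂(volume : Measure M), x ∈ stochasticBasin d f K → x ∈ stochasticBasin d f K') →
    K ⊆ K'

/-- Global empiric stochastic stability: the basin has full Lebesgue measure. -/
structure IsGloballyEmpiricallyStable (d : ProbabilityMeasure M → ProbabilityMeasure M → ℝ)
    (f : C(M, M)) (K : Set (ProbabilityMeasure M)) : Prop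
    extends IsEmpiricallyStable d f K where
  basin_full : ∀ᵐ x ∂(volume : Measure M), x ∈ stochasticBasin d f K

end General

instance isOpenPosMeasure_unitInterval : (volume : Measure I).IsOpenPosMeasure := by
  refine ⟨fun U hU hne h0 => ?_⟩
  obtain ⟨V, hV, rfl⟩ := isOpen_induced_iff.1 hU
  obtain ⟨x, hx⟩ := hne
  have hcl : (x : ℝ) ∈ closure (Ioo (0 : ℝ) 1) := by
    rw [closure_Ioo zero_ne_one]
    exact x.2
  have hW : (V ∩ Ioo (0 : ℝ) 1).Nonempty := mem_closure_iff.1 hcl V hV hx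
  have hpos : 0 < (volume : Measure ℝ) (V ∩ Ioo (0 : ℝ) 1) :=
    (hV.inter isOpen_Ioo).measure_pos volume hW
  rw [unitInterval.volume_apply] at h0
  refine hpos.ne' (measure_mono_null ?_ h0)
  rintro y ⟨hyV, hy⟩
  exact ⟨⟨y, hy.1.le, hy.2.le⟩, hyV, rfl⟩

end EmpiricStability

end

/-! For fixed `n`, the measures `σ_{ε,n,x}` converge as `ε → 0` to the empirical measure of the
deterministic orbit, uniformly in `x` (`exists_dist_empiricStochastic_lt`). Hence noise disappears
from the basin: `x` lies in the basin of a nonempty compact `K` exactly when every weak* limit of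
its empirical measures lies in `K` (`mem_stochasticBasin_iff`). The only candidate for `K` is
therefore the smallest closed set containing the limit measures of almost every point, that is, the
set of pseudo-physical measures. Egorov's theorem supplies the set of uniform approximation, and
minimality gives uniqueness.

Two generic properties of `f` then suffice. First, every ergodic `μ` is pseudo-physical. By the mean
ergodic theorem some orbit returns close to its start with averages close to those of `μ`; a small
perturbation of `f` closes it into a periodic orbit near which the map is locally constant
(`exists_closing`). The resulting trapping set has interior, hence positive Lebesgue measure,
survives small perturbations, and forces a pseudo-physical measure near `μ`. A countable family of
such open conditions and the closedness of the pseudo-physical set finish the argument.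

Second, an open dense set of maps has two disjoint trapping sets. A continuous function then has
integral `0` or `1` against each pseudo-physical measure, whereas the convex set of invariant
measures joins any of these to measures with intermediate integrals
(`interior_pseudoPhysicalMeasures_eq_empty`). -/

namespace EmpiricStability

/-! ### Essential range of a set-valued map -/

section EssentialRange

variable {X Y : Type*} [MeasurableSpace X] [TopologicalSpace Y]

/-- The essential range of a set-valued map `L` with respect to the measure `m`. -/
def essentialRange (m : Measure X) (L : X → Set Y) : Set Y :=
  {y | ∀ U ∈ 𝓝 y, m {x | (L x ∩ U).Nonempty} ≠ 0}

variable {m : Measure X} {L : X → Set Y}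

lemma isClosed_essentialRange : IsClosed (essentialRange m L) := by
  rw [← isOpen_compl_iff, isOpen_iff_mem_nhds]
  intro y hy
  simp only [essentialRange, mem_compl_iff, mem_ofPred_eq, not_forall, not_not] at hy
  obtain ⟨U, hU, h0⟩ := hy
  filter_upwards [eventually_mem_nhds_iff.2 hU] with z hz hmem
  exact hmem U hz h0

/-- Each point outside the essential range has a neighbourhood met by `L x` only for a null set of
`x`. Second countability leaves countably many such neighbourhoods, so the null sets can be united.
-/
lemma ae_subset_essentialRange [SecondCountableTopology Y] :
    ∀ᵐ x ∂m, L x ⊆ essentialRange m L := by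
  have h (y : Y) (hy : y ∈ (essentialRange m L)ᶜ) :
      ∃ U, IsOpen U ∧ y ∈ U ∧ m {x | (L x ∩ U).Nonempty} = 0 := by
    simp only [essentialRange, mem_compl_iff, mem_ofPred_eq, not_forall, not_not] at hy
    obtain ⟨U, hU, h0⟩ := hy
    obtain ⟨V, hVU, hV, hyV⟩ := mem_nhds_iff.1 hU
    exact ⟨V, hV, hyV, measure_mono_null
      (fun x hx => hx.mono (inter_subset_inter_right _ hVU)) h0⟩
  choose! U hUo hyU hU0 using h
  obtain ⟨t, htS, htc, ht⟩ := TopologicalSpace.countable_cover_nhdsWithin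
    (s := (essentialRange m L)ᶜ) (f := U)
    (fun y hy => mem_nhdsWithin_of_mem_nhds ((hUo y hy).mem_nhds (hyU y hy)))
  have hall : ∀ᵐ x ∂m, ∀ y ∈ t, ¬ (L x ∩ U y).Nonempty := by
    rw [ae_ball_iff htc]
    intro y hy
    rw [ae_iff]
    simpa using hU0 y (htS hy)
  filter_upwards [hall] with x hx z hz
  by_contra hzE
  obtain ⟨y, hy, hzy⟩ := mem_iUnion₂.1 (ht hzE)
  exact hx y hy ⟨z, hz, hzy⟩

/-- With the two preceding lemmas this characterizes the essential range as the smallest closed set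
containing almost every `L x`, the form in which minimality of the stable set is proved. -/
lemma essentialRange_subset {F : Set Y} (hF : IsClosed F) (h : ∀ᵐ x ∂m, L x ⊆ F) :
    essentialRange m L ⊆ F := by
  intro y hy
  by_contra hyF
  refine hy Fᶜ (hF.isOpen_compl.mem_nhds hyF) (measure_mono_null ?_ (ae_iff.1 h))
  rintro x ⟨z, hz, hzF⟩ hx
  exact hzF (hx hz)

lemma essentialRange_nonempty [SecondCountableTopology Y] (hm : m ≠ 0)
    (hL : ∀ x, (L x).Nonempty) : (essentialRange m L).Nonempty := by
  have := ae_neBot.2 hm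
  obtain ⟨x, hx⟩ := (ae_subset_essentialRange (m := m) (L := L)).exists
  exact (hL x).mono hx

end EssentialRange

/-! ### Empirical measures and their weak* limits -/

section Empirical

variable {M : Type*} [MetricSpace M] [CompactSpace M] [MeasurableSpace M] [BorelSpace M]

/-- The empirical probability `(1/n) ∑_{j=1}^n δ_{f^j x}`. -/
noncomputable def empiricalMeasure (f : C(M, M)) (n : ℕ+) (x : M) : ProbabilityMeasure M :=
  ⟨((n : ℕ) : ℝ≥0∞)⁻¹ • ∑ j ∈ Finset.Icc 1 (n : ℕ), Measure.dirac (f^[j] x), by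
    constructor
    simp only [Measure.smul_apply, Measure.finsetSum_apply, measure_univ, Finset.sum_const,
      Nat.card_Icc, Nat.add_sub_cancel, nsmul_eq_mul, mul_one, smul_eq_mul]
    exact ENNReal.inv_mul_cancel (by exact_mod_cast n.ne_zero) (ENNReal.natCast_ne_top _)⟩

lemma integrable_continuousMap (φ : C(M, ℝ)) (μ : Measure M) [IsFiniteMeasure μ] :
    Integrable φ μ :=
  (BoundedContinuousFunction.mkOfCompact φ).integrable μ

lemma integral_inv_smul_sum {ι : Type*} (s : Finset ι) (μ : ι → Measure M)
    [∀ i, IsFiniteMeasure (μ i)] (n : ℕ) (φ : C(M, ℝ)) :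
    ∫ y, φ y ∂((n : ℝ≥0∞)⁻¹ • ∑ i ∈ s, μ i) = (n : ℝ)⁻¹ * ∑ i ∈ s, ∫ y, φ y ∂(μ i) := by
  rw [integral_smul_measure, integral_finsetSum_measure
    (fun i _ => integrable_continuousMap φ (μ i))]
  simp

lemma integral_empiricalMeasure (f : C(M, M)) (n : ℕ+) (x : M) (φ : C(M, ℝ)) :
    ∫ y, φ y ∂(empiricalMeasure f n x : Measure M) =
      ((n : ℕ) : ℝ)⁻¹ * ∑ j ∈ Finset.Icc 1 (n : ℕ), φ (f^[j] x) := by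
  rw [empiricalMeasure, ProbabilityMeasure.coe_mk, integral_inv_smul_sum]
  simp

lemma tendsto_iff_forall_continuousMap {γ : Type*} {F : Filter γ}
    {μs : γ → ProbabilityMeasure M} {μ : ProbabilityMeasure M} :
    Tendsto μs F (𝓝 μ) ↔ ∀ φ : C(M, ℝ),
      Tendsto (fun i => ∫ y, φ y ∂(μs i : Measure M)) F (𝓝 (∫ y, φ y ∂(μ : Measure M))) := by
  rw [ProbabilityMeasure.tendsto_iff_forall_integral_tendsto]
  exact ⟨fun h φ => h (BoundedContinuousFunction.mkOfCompact φ),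
    fun h φ => h φ.toContinuousMap⟩

omit [CompactSpace M] in
lemma eq_of_forall_integral_eq {μ ν : ProbabilityMeasure M}
    (h : ∀ φ : C(M, ℝ), ∫ y, φ y ∂(μ : Measure M) = ∫ y, φ y ∂(ν : Measure M)) : μ = ν := by
  apply ProbabilityMeasure.toMeasure_injective
  exact ext_of_forall_integral_eq_of_IsFiniteMeasure fun φ => h φ.toContinuousMap

lemma continuous_integral (φ : C(M, ℝ)) :
    Continuous fun μ : ProbabilityMeasure M => ∫ y, φ y ∂(μ : Measure M) :=
  ProbabilityMeasure.continuous_integral_continuousMap φ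

lemma continuous_empiricalMeasure (f : C(M, M)) (n : ℕ+) :
    Continuous (empiricalMeasure f n) := by
  refine continuous_iff_continuousAt.2 fun x => tendsto_iff_forall_continuousMap.2 fun φ => ?_
  simp only [integral_empiricalMeasure]
  refine Continuous.tendsto (continuous_const.mul (continuous_finsetSum _ fun j _ => ?_)) x
  exact φ.continuous.comp (f.continuous.iterate j)

instance : SecondCountableTopology (ProbabilityMeasure M) := by
  let _ := TopologicalSpace.metrizableSpaceMetric (ProbabilityMeasure M)
  infer_instance

/-- The weak* limits of the empirical probabilities along the orbit of `x`. -/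
def limitMeasures (f : C(M, M)) (x : M) : Set (ProbabilityMeasure M) :=
  {ν | MapClusterPt ν atTop fun n => empiricalMeasure f n x}

lemma limitMeasures_nonempty (f : C(M, M)) (x : M) : (limitMeasures f x).Nonempty := by
  obtain ⟨ν, -, hν⟩ := isCompact_univ.exists_mapClusterPt (f := atTop)
    (u := fun n => empiricalMeasure f n x) (by simp)
  exact ⟨ν, hν⟩

omit [CompactSpace M] in
lemma mem_of_mem_limitMeasures {f : C(M, M)} {x : M} {ν : ProbabilityMeasure M}
    (hν : ν ∈ limitMeasures f x) {F : Set (ProbabilityMeasure M)} (hF : IsClosed F)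
    (h : ∀ᶠ n in atTop, empiricalMeasure f n x ∈ F) : ν ∈ F := by
  by_contra hνF
  obtain ⟨n, hn, hn'⟩ :=
    ((MapClusterPt.frequently hν (hF.isOpen_compl.mem_nhds hνF)).and_eventually h).exists
  exact hn hn'

/-- Otherwise the empirical measures would be frequently in the compact complement of `U` and
accumulate there. -/
lemma eventually_mem_of_limitMeasures_subset {f : C(M, M)} {x : M}
    {U : Set (ProbabilityMeasure M)} (hU : IsOpen U) (h : limitMeasures f x ⊆ U) :
    ∀ᶠ n in atTop, empiricalMeasure f n x ∈ U := by
  by_contra hcon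
  obtain ⟨ν, hνU, hν⟩ := hU.isClosed_compl.isCompact.exists_mapClusterPt_of_frequently
    (l := atTop) (f := fun n => empiricalMeasure f n x) (not_eventually.1 hcon)
  exact hνU (h hν)

lemma tendsto_inv_pnat_atTop : Tendsto (fun n : ℕ+ => ((n : ℕ) : ℝ)⁻¹) atTop (𝓝 0) :=
  (tendsto_inv_atTop_nhds_zero_nat (𝕜 := ℝ)).comp tendsto_PNat_val_atTop_atTop

lemma mem_invariantMeasures_iff {M : Type*} [MetricSpace M] [CompactSpace M] [MeasureSpace M]
    [BorelSpace M] {f : C(M, M)} {μ : ProbabilityMeasure M} :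
    μ ∈ invariantMeasures f ↔ μ.map f.continuous.measurable.aemeasurable = μ := by
  constructor
  · intro h
    apply ProbabilityMeasure.toMeasure_injective
    rw [ProbabilityMeasure.toMeasure_map]
    exact h.map_eq
  · intro h
    refine ⟨f.continuous.measurable, ?_⟩
    rw [← ProbabilityMeasure.toMeasure_map _ f.continuous.measurable.aemeasurable, h]

end Empirical

/-! ### Invariant and pseudo-physical measures -/

section Invariant

variable {M : Type*} [MetricSpace M] [CompactSpace M] [MeasureSpace M] [BorelSpace M]

lemma isClosed_invariantMeasures (f : C(M, M)) : IsClosed (invariantMeasures f) := by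
  simp only [show invariantMeasures f = {μ | μ.map f.continuous.measurable.aemeasurable = μ} from
    Set.ext fun μ => mem_invariantMeasures_iff]
  exact isClosed_eq (ProbabilityMeasure.continuous_map f.continuous) continuous_id

lemma mem_invariantMeasures_of_integral {f : C(M, M)} {μ : ProbabilityMeasure M}
    (h : ∀ φ : C(M, ℝ), ∫ y, φ (f y) ∂(μ : Measure M) = ∫ y, φ y ∂(μ : Measure M)) :
    μ ∈ invariantMeasures f := by
  refine mem_invariantMeasures_iff.2 (eq_of_forall_integral_eq fun φ => ?_)
  rw [ProbabilityMeasure.toMeasure_map, integral_map f.continuous.measurable.aemeasurable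
    φ.continuous.aestronglyMeasurable, h]

lemma limitMeasures_subset_invariantMeasures (f : C(M, M)) (x : M) :
    limitMeasures f x ⊆ invariantMeasures f := by
  intro ν hν
  refine mem_invariantMeasures_of_integral fun φ => ?_
  have hcont : Continuous fun μ : ProbabilityMeasure M =>
      |∫ y, (φ.comp f) y ∂(μ : Measure M) - ∫ y, φ y ∂(μ : Measure M)| :=
    ((continuous_integral _).sub (continuous_integral φ)).abs
  have hb (n : ℕ+) : |∫ y, (φ.comp f) y ∂(empiricalMeasure f n x : Measure M) -
      ∫ y, φ y ∂(empiricalMeasure f n x : Measure M)| ≤ ((n : ℕ) : ℝ)⁻¹ * (2 * ‖φ‖) := by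
    rw [integral_empiricalMeasure, integral_empiricalMeasure, ← mul_sub, ← Finset.sum_sub_distrib,
      abs_mul, abs_of_nonneg (by positivity)]
    gcongr
    -- The sum telescopes, so the defect of invariance is `O(1/n)`.
    have h1 : ∑ j ∈ Finset.Icc 1 (n : ℕ), ((φ.comp f) (f^[j] x) - φ (f^[j] x)) =
        φ (f^[(n : ℕ) + 1] x) - φ (f^[1] x) := by
      simp only [ContinuousMap.comp_apply, ← Function.iterate_succ_apply' f]
      rw [← Finset.Ico_add_one_right_eq_Icc]
      exact Finset.sum_Ico_sub (fun j => φ (f^[j] x)) (by simp)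
    rw [h1]
    have h2 := φ.norm_coe_le_norm (f^[(n : ℕ) + 1] x)
    have h3 := φ.norm_coe_le_norm (f^[1] x)
    rw [Real.norm_eq_abs] at h2 h3
    linarith [abs_sub (φ (f^[(n : ℕ) + 1] x)) (φ (f^[1] x))]
  have hle : |∫ y, (φ.comp f) y ∂(ν : Measure M) - ∫ y, φ y ∂(ν : Measure M)| ≤ 0 := by
    refine le_of_forall_pos_le_add fun δ hδ => ?_
    refine mem_of_mem_limitMeasures hν (isClosed_le hcont (continuous_const (y := 0 + δ))) ?_
    have hlim := tendsto_inv_pnat_atTop.mul_const (2 * ‖φ‖)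
    rw [zero_mul] at hlim
    filter_upwards [hlim.eventually (gt_mem_nhds hδ)] with n hn
    simp only [zero_add]
    exact (hb n).trans hn.le
  exact sub_eq_zero.1 (abs_nonpos_iff.1 hle)

/-- The pseudo-physical measures: those approximated by limits of the empirical probabilities
along the orbits of a set of points of positive measure. -/
def pseudoPhysicalMeasures (f : C(M, M)) : Set (ProbabilityMeasure M) :=
  essentialRange (volume : Measure M) (limitMeasures f)

omit [CompactSpace M] in
lemma isClosed_pseudoPhysicalMeasures (f : C(M, M)) : IsClosed (pseudoPhysicalMeasures f) :=
  isClosed_essentialRange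

lemma ae_limitMeasures_subset (f : C(M, M)) :
    ∀ᵐ x ∂(volume : Measure M), limitMeasures f x ⊆ pseudoPhysicalMeasures f :=
  ae_subset_essentialRange

lemma pseudoPhysicalMeasures_subset_invariantMeasures (f : C(M, M)) :
    pseudoPhysicalMeasures f ⊆ invariantMeasures f :=
  essentialRange_subset (isClosed_invariantMeasures f)
    (.of_forall (limitMeasures_subset_invariantMeasures f))

end Invariant

/-! ### The zero-noise limit and the unique globally stable set -/

section ZeroNoise

variable {M : Type*} [MetricSpace M] [CompactSpace M] [MeasureSpace M] [BorelSpace M]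
  [IsFiniteMeasure (volume : Measure M)] [(volume : Measure M).IsOpenPosMeasure]

omit [(volume : Measure M).IsOpenPosMeasure] in
-- A noisy step lands within `ε` of the image, and `f` is uniformly continuous. Thus `j` noisy steps
-- stay within `δ` of the true orbit almost surely, for a noise level independent of `x`.
lemma exists_iterate_transferDual_compl_ball (f : C(M, M)) (j : ℕ) {δ : ℝ} (hδ : 0 < δ) :
    ∃ ε₀ : ℝ, 0 < ε₀ ∧ ∀ ε : ℝ, 0 < ε → ε ≤ ε₀ → ∀ x : M,
      (transferDual f ε)^[j] (Measure.dirac x) (Metric.ball (f^[j] x) δ)ᶜ = 0 := by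
  induction j generalizing δ with
  | zero =>
    refine ⟨1, one_pos, fun ε _ _ x => ?_⟩
    simp [hδ]
  | succ j ih =>
    obtain ⟨η, hη, hfη⟩ := Metric.uniformContinuous_iff.1
      (CompactSpace.uniformContinuous_of_continuous f.continuous) (δ / 2) (half_pos hδ)
    obtain ⟨ε₀, hε₀, h⟩ := ih hη
    refine ⟨min ε₀ (δ / 2), lt_min hε₀ (half_pos hδ), fun ε hε hle x => ?_⟩
    rw [Function.iterate_succ_apply', Function.iterate_succ_apply', transferDual,
      Measure.bind_apply Metric.isOpen_ball.measurableSet.compl (Kernel.aemeasurable _),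
      lintegral_eq_zero_iff (Kernel.measurable_coe _ Metric.isOpen_ball.measurableSet.compl)]
    have hae : ∀ᵐ y ∂((transferDual f ε)^[j] (Measure.dirac x)), y ∈ Metric.ball (f^[j] x) η :=
      ae_iff.2 (h ε hε (hle.trans (min_le_left _ _)) x)
    filter_upwards [hae] with y hy
    have hsub : Metric.ball (f y) ε ⊆ Metric.ball (f (f^[j] x)) δ := by
      refine Metric.ball_subset_ball' ?_
      have h1 := hfη (Metric.mem_ball.1 hy)
      have h2 := hle.trans (min_le_right _ _)
      linarith
    change (volume : Measure M)[|Metric.ball (f y) ε] _ = 0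
    rw [cond_apply Metric.isOpen_ball.measurableSet,
      disjoint_iff_inter_eq_empty.1 (disjoint_compl_right.mono_left hsub)]
    simp

lemma exists_abs_integral_iterate_transferDual_sub_le (f : C(M, M)) (j : ℕ) (φ : C(M, ℝ)) {δ : ℝ}
    (hδ : 0 < δ) : ∃ ε₀ : ℝ, 0 < ε₀ ∧ ∀ ε : ℝ, 0 < ε → ε ≤ ε₀ → ∀ x : M,
      |∫ y, φ y ∂((transferDual f ε)^[j] (Measure.dirac x)) - φ (f^[j] x)| ≤ δ := by
  obtain ⟨η, hη, hφη⟩ := Metric.uniformContinuous_iff.1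
    (CompactSpace.uniformContinuous_of_continuous φ.continuous) δ hδ
  obtain ⟨ε₀, hε₀, h⟩ := exists_iterate_transferDual_compl_ball f j hη
  refine ⟨ε₀, hε₀, fun ε hε hle x => ?_⟩
  have := isProbabilityMeasure_iterate f hε x j
  have hae : ∀ᵐ y ∂((transferDual f ε)^[j] (Measure.dirac x)),
      ‖φ y - φ (f^[j] x)‖ ≤ δ := by
    have : ∀ᵐ y ∂((transferDual f ε)^[j] (Measure.dirac x)), y ∈ Metric.ball (f^[j] x) η :=
      ae_iff.2 (h ε hε hle x)
    filter_upwards [this] with y hy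
    exact (hφη (Metric.mem_ball.1 hy)).le
  have key := norm_integral_le_of_norm_le_const hae
  rw [integral_sub (integrable_continuousMap φ _) (integrable_const _)] at key
  simpa using key

lemma integral_empiricStochastic (f : C(M, M)) {ε : ℝ} (hε : 0 < ε) (n : ℕ+) (x : M)
    (φ : C(M, ℝ)) :
    ∫ y, φ y ∂(empiricStochastic f hε n x : Measure M) = ((n : ℕ) : ℝ)⁻¹ *
      ∑ j ∈ Finset.Icc 1 (n : ℕ), ∫ y, φ y ∂((transferDual f ε)^[j] (Measure.dirac x)) := by
  have := isProbabilityMeasure_iterate f hε x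
  rw [empiricStochastic, ProbabilityMeasure.coe_mk, integral_inv_smul_sum]

lemma eventually_abs_integral_empiricStochastic_sub_le (f : C(M, M)) (n : ℕ+) (φ : C(M, ℝ))
    {δ : ℝ} (hδ : 0 < δ) : ∀ᶠ ε : {ε : ℝ // 0 < ε} in comap Subtype.val (𝓝 0), ∀ x : M,
      |∫ y, φ y ∂(empiricStochastic f ε.2 n x : Measure M) -
        ∫ y, φ y ∂(empiricalMeasure f n x : Measure M)| ≤ δ := by
  have hall : ∀ᶠ ε : {ε : ℝ // 0 < ε} in comap Subtype.val (𝓝 0),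
      ∀ j ∈ Finset.Icc 1 (n : ℕ), ∀ x : M,
      |∫ y, φ y ∂((transferDual f ε)^[j] (Measure.dirac x)) - φ (f^[j] x)| ≤ δ := by
    refine (Finset.eventually_all _).2 fun j _ => ?_
    obtain ⟨ε₀, hε₀, h⟩ := exists_abs_integral_iterate_transferDual_sub_le f j φ hδ
    filter_upwards [preimage_mem_comap (Iio_mem_nhds hε₀)] with ε hε
    exact h ε ε.2 (mem_Iio.1 hε).le
  filter_upwards [hall] with ε hε x
  rw [integral_empiricStochastic, integral_empiricalMeasure, ← mul_sub, ← Finset.sum_sub_distrib,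
    abs_mul, abs_of_nonneg (by positivity)]
  have h1 : |∑ j ∈ Finset.Icc 1 (n : ℕ), (∫ y, φ y ∂((transferDual f ε)^[j] (Measure.dirac x)) -
      φ (f^[j] x))| ≤ ∑ j ∈ Finset.Icc 1 (n : ℕ), δ :=
    (Finset.abs_sum_le_sum_abs _ _).trans (Finset.sum_le_sum fun j hj => hε j hj x)
  have hn : (0 : ℝ) < (n : ℕ) := by exact_mod_cast n.pos
  rw [inv_mul_le_iff₀ hn]
  simpa using h1

lemma tendsto_empiricStochastic (f : C(M, M)) (n : ℕ+) (x : M) :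
    Tendsto (fun p : {ε : ℝ // 0 < ε} × M => empiricStochastic f p.1.2 n p.2)
      (comap Subtype.val (𝓝 0) ×ˢ 𝓝 x) (𝓝 (empiricalMeasure f n x)) := by
  refine tendsto_iff_forall_continuousMap.2 fun φ => Metric.tendsto_nhds.2 fun δ hδ => ?_
  have h1 := (eventually_abs_integral_empiricStochastic_sub_le f n φ (half_pos hδ)).prod_inl (𝓝 x)
  have h2 := (Metric.tendsto_nhds.1
    (((continuous_integral φ).comp (continuous_empiricalMeasure f n)).tendsto x) (δ / 2)
    (half_pos hδ)).prod_inr (comap (Subtype.val : {ε : ℝ // 0 < ε} → ℝ) (𝓝 0))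
  filter_upwards [h1, h2] with p hp1 hp2
  refine (dist_triangle _ (∫ y, φ y ∂(empiricalMeasure f n p.2 : Measure M)) _).trans_lt ?_
  rw [← add_halves δ]
  exact add_lt_add_of_le_of_lt (hp1 p.2) hp2

variable {d : ProbabilityMeasure M → ProbabilityMeasure M → ℝ}

omit [CompactSpace M] [IsFiniteMeasure (volume : Measure M)]
  [(volume : Measure M).IsOpenPosMeasure] in
lemma IsWeakStarMetric.exists_metricSpace (hd : IsWeakStarMetric d) :
    ∃ D : MetricSpace (ProbabilityMeasure M),
      D.toUniformSpace.toTopologicalSpace =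
        (inferInstance : TopologicalSpace (ProbabilityMeasure M)) ∧
      d = D.dist := by
  obtain ⟨D, hD, htop⟩ := hd
  exact ⟨D, htop, by ext μ ν; exact (hD μ ν).symm⟩

/-- Joint convergence in `(ε, x)` gives the estimate near each point for an arbitrary metric;
compactness of `M` then makes the noise level independent of `x`, as condition (a) requires. -/
lemma IsWeakStarMetric.exists_dist_empiricStochastic_lt (hd : IsWeakStarMetric d) (f : C(M, M))
    (n : ℕ+) {ρ : ℝ} (hρ : 0 < ρ) : ∃ ε₀ : ℝ, 0 < ε₀ ∧ ∀ (ε : ℝ) (hε : 0 < ε), ε ≤ ε₀ → ∀ x : M,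
      d (empiricStochastic f hε n x) (empiricalMeasure f n x) < ρ := by
  obtain ⟨D₀, htop, rfl⟩ := hd.exists_metricSpace
  -- The metric now carries the weak* topology definitionally, so the continuity lemmas apply to it.
  let D : MetricSpace (ProbabilityMeasure M) := D₀.replaceTopology htop.symm
  have hloc : ∀ x : M, ∀ᶠ p : {ε : ℝ // 0 < ε} × M in comap Subtype.val (𝓝 0) ×ˢ 𝓝 x,
      dist (empiricStochastic f p.1.2 n p.2) (empiricalMeasure f n p.2) < ρ := by
    intro x
    have h1 := tendsto_empiricStochastic f n x
    have h2 := ((continuous_empiricalMeasure f n).tendsto x).comp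
      (tendsto_snd (f := comap (Subtype.val : {ε : ℝ // 0 < ε} → ℝ) (𝓝 0)))
    have h3 := h1.dist h2
    rw [dist_self] at h3
    exact h3.eventually (gt_mem_nhds hρ)
  have hall : ∀ᶠ ε : {ε : ℝ // 0 < ε} in comap Subtype.val (𝓝 0), ∀ x ∈ (univ : Set M),
      dist (empiricStochastic f ε.2 n x) (empiricalMeasure f n x) < ρ := by
    refine isCompact_univ.induction_on (p := fun s => ∀ᶠ ε : {ε : ℝ // 0 < ε} in
      comap Subtype.val (𝓝 0), ∀ x ∈ s,
      dist (empiricStochastic f ε.2 n x) (empiricalMeasure f n x) < ρ) (by simp)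
      (fun s t hst ht => ht.mono fun ε h x hx => h x (hst hx))
      (fun s t hs ht => (hs.and ht).mono fun ε h x hx => hx.elim (h.1 x) (h.2 x)) fun x _ => ?_
    obtain ⟨pa, hpa, pb, hpb, h⟩ := eventually_prod_iff.1 (hloc x)
    exact ⟨{y | pb y}, mem_nhdsWithin_of_mem_nhds hpb, hpa.mono fun ε hε y hy => h hε hy⟩
  obtain ⟨t, ht, hsub⟩ := mem_comap.1 hall
  obtain ⟨r, hr, hball⟩ := Metric.mem_nhds_iff.1 ht
  refine ⟨r / 2, half_pos hr, fun ε hε hle x => ?_⟩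
  have hmem : (⟨ε, hε⟩ : {ε : ℝ // 0 < ε}) ∈ Subtype.val ⁻¹' t := by
    refine hball ?_
    rw [Metric.mem_ball, Real.dist_eq, sub_zero, abs_of_pos hε]
    linarith
  exact hsub hmem x (mem_univ x)

lemma IsWeakStarMetric.distToSet_lt_add (hd : IsWeakStarMetric d) {K : Set (ProbabilityMeasure M)}
    (hK : K.Nonempty) {μ ν : ProbabilityMeasure M} {a b : ℝ} (h1 : d μ ν < a)
    (h2 : distToSet d ν K < b) : distToSet d μ K < a + b := by
  obtain ⟨D, -, rfl⟩ := hd.exists_metricSpace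
  obtain ⟨_, ⟨κ, hκ, rfl⟩, hlt⟩ := exists_lt_of_csInf_lt (hK.image _) h2
  refine (csInf_le ⟨0, ?_⟩ (mem_image_of_mem _ hκ)).trans_lt
    ((D.dist_triangle μ ν κ).trans_lt (add_lt_add h1 hlt))
  rintro _ ⟨κ, -, rfl⟩
  exact dist_nonneg

lemma IsWeakStarMetric.continuous_distToSet (hd : IsWeakStarMetric d)
    {K : Set (ProbabilityMeasure M)} (hK : K.Nonempty) :
    Continuous fun μ => distToSet d μ K := by
  have hlt := @IsWeakStarMetric.distToSet_lt_add _ _ _ _ _ _ _ d hd K hK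
  obtain ⟨D₀, htop, rfl⟩ := hd.exists_metricSpace
  let D : MetricSpace (ProbabilityMeasure M) := D₀.replaceTopology htop.symm
  have hle (μ ν : ProbabilityMeasure M) :
      distToSet D₀.dist μ K ≤ dist μ ν + distToSet D₀.dist ν K := by
    refine le_of_forall_pos_le_add fun δ hδ => ?_
    have h := hlt (μ := μ) (ν := ν) (lt_add_of_pos_right _ (half_pos hδ))
      (lt_add_of_pos_right _ (half_pos hδ))
    refine h.le.trans (le_of_eq ?_)
    change D₀.dist μ ν + δ / 2 + _ = D₀.dist μ ν + _ + δ
    ring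
  refine (LipschitzWith.of_le_add fun μ ν => ?_).continuous
  rw [add_comm]
  exact hle μ ν

lemma IsWeakStarMetric.distToSet_nonneg (hd : IsWeakStarMetric d)
    (K : Set (ProbabilityMeasure M)) (μ : ProbabilityMeasure M) : 0 ≤ distToSet d μ K := by
  obtain ⟨D, -, rfl⟩ := hd.exists_metricSpace
  refine Real.sInf_nonneg ?_
  rintro _ ⟨κ, -, rfl⟩
  exact dist_nonneg

lemma IsWeakStarMetric.distToSet_lt_of_mem (hd : IsWeakStarMetric d)
    {K : Set (ProbabilityMeasure M)} {μ : ProbabilityMeasure M} (hμ : μ ∈ K) {ρ : ℝ} (hρ : 0 < ρ) :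
    distToSet d μ K < ρ := by
  obtain ⟨D, -, rfl⟩ := hd.exists_metricSpace
  refine (csInf_le ⟨0, ?_⟩ (mem_image_of_mem _ hμ)).trans_lt ?_
  · rintro _ ⟨κ, -, rfl⟩
    exact dist_nonneg
  · exact (D.dist_self μ).trans_lt hρ

lemma IsWeakStarMetric.mem_of_distToSet_le_zero (hd : IsWeakStarMetric d)
    {K : Set (ProbabilityMeasure M)} (hK : IsClosed K) (hne : K.Nonempty)
    {μ : ProbabilityMeasure M} (hμ : distToSet d μ K ≤ 0) : μ ∈ K := by
  obtain ⟨D₀, htop, rfl⟩ := hd.exists_metricSpace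
  let D : MetricSpace (ProbabilityMeasure M) := D₀.replaceTopology htop.symm
  rw [← hK.closure_eq, Metric.mem_closure_iff]
  intro δ hδ
  obtain ⟨_, ⟨κ, hκ, rfl⟩, hlt⟩ := exists_lt_of_csInf_lt (hne.image _) (hμ.trans_lt hδ)
  exact ⟨κ, hκ, hlt⟩

/-- In the basin, the random perturbations may be replaced by the deterministic averages. -/
lemma IsWeakStarMetric.mem_stochasticBasin_iff (hd : IsWeakStarMetric d) (f : C(M, M))
    {K : Set (ProbabilityMeasure M)} (hKc : IsClosed K) (hK : K.Nonempty) (x : M) :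
    x ∈ stochasticBasin d f K ↔ limitMeasures f x ⊆ K := by
  constructor
  · intro hx ν hν
    refine hd.mem_of_distToSet_le_zero hKc hK (le_of_forall_pos_le_add fun δ hδ => ?_)
    rw [zero_add]
    refine mem_of_mem_limitMeasures hν
      (isClosed_le (hd.continuous_distToSet hK) (continuous_const (y := δ))) ?_
    obtain ⟨N, hN⟩ := hx (δ / 2) (half_pos hδ)
    filter_upwards [eventually_ge_atTop N] with n hn
    obtain ⟨ε₁, hε₁, h1⟩ := hN n hn
    obtain ⟨ε₂, hε₂, h2⟩ := hd.exists_dist_empiricStochastic_lt f n (half_pos hδ)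
    have hε : 0 < min ε₁ ε₂ := lt_min hε₁ hε₂
    have h3 := h2 _ hε (min_le_right _ _) x
    have h4 := h1 _ hε (min_le_left _ _)
    have h5 : d (empiricalMeasure f n x) (empiricStochastic f hε n x) < δ / 2 := by
      obtain ⟨D, -, rfl⟩ := hd.exists_metricSpace
      exact (D.dist_comm _ _).trans_lt h3
    exact ((hd.distToSet_lt_add hK h5 h4).trans_eq (add_halves δ)).le
  · intro hx ρ hρ
    have hopen : IsOpen {μ | distToSet d μ K < ρ / 2} :=
      isOpen_lt (hd.continuous_distToSet hK) continuous_const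
    obtain ⟨N, hN⟩ := eventually_atTop.1 (eventually_mem_of_limitMeasures_subset hopen
      (hx.trans fun μ hμ => hd.distToSet_lt_of_mem hμ (half_pos hρ)))
    refine ⟨N, fun n hn => ?_⟩
    obtain ⟨ε₀, hε₀, h⟩ := hd.exists_dist_empiricStochastic_lt f n (half_pos hρ)
    refine ⟨ε₀, hε₀, fun ε hε hle => ?_⟩
    exact (hd.distToSet_lt_add hK (h ε hε hle x) (hN n hn)).trans_eq (add_halves ρ)

lemma IsWeakStarMetric.ae_mem_stochasticBasin (hd : IsWeakStarMetric d) (f : C(M, M))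
    (hne : (pseudoPhysicalMeasures f).Nonempty) :
    ∀ᵐ x ∂(volume : Measure M), x ∈ stochasticBasin d f (pseudoPhysicalMeasures f) := by
  filter_upwards [ae_limitMeasures_subset f] with x hx
  exact (hd.mem_stochasticBasin_iff f (isClosed_pseudoPhysicalMeasures f) hne x).2 hx

lemma IsWeakStarMetric.pseudoPhysicalMeasures_subset (hd : IsWeakStarMetric d) (f : C(M, M))
    {K : Set (ProbabilityMeasure M)} (hKc : IsClosed K) (hK : K.Nonempty)
    (h : ∀ᵐ x ∂(volume : Measure M), x ∈ stochasticBasin d f K) :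
    pseudoPhysicalMeasures f ⊆ K :=
  essentialRange_subset hKc (h.mono fun x hx => (hd.mem_stochasticBasin_iff f hKc hK x).1 hx)

/-- The pseudo-physical measures form a globally empirically stable set. -/
theorem IsWeakStarMetric.isGloballyEmpiricallyStable (hd : IsWeakStarMetric d)
    (hvol : (volume : Measure M) ≠ 0) (f : C(M, M)) :
    IsGloballyEmpiricallyStable d f (pseudoPhysicalMeasures f) := by
  have hclosed := isClosed_pseudoPhysicalMeasures f
  have hne : (pseudoPhysicalMeasures f).Nonempty :=
    essentialRange_nonempty hvol (limitMeasures_nonempty f)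
  have hbasin := hd.ae_mem_stochasticBasin f hne
  refine ⟨⟨hne, hclosed.isCompact, pseudoPhysicalMeasures_subset_invariantMeasures f, ?_, ?_⟩,
    hbasin⟩
  · have hcont (n : ℕ+) :
        Continuous fun x => distToSet d (empiricalMeasure f n x) (pseudoPhysicalMeasures f) :=
      (hd.continuous_distToSet hne).comp (continuous_empiricalMeasure f n)
    have hlim : ∀ᵐ x ∂(volume : Measure M), Tendsto
        (fun n => distToSet d (empiricalMeasure f n x) (pseudoPhysicalMeasures f)) atTop (𝓝 0) := by
      filter_upwards [ae_limitMeasures_subset f] with x hx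
      refine Metric.tendsto_nhds.2 fun ρ hρ => ?_
      have hopen : IsOpen {μ | distToSet d μ (pseudoPhysicalMeasures f) < ρ} :=
        isOpen_lt (hd.continuous_distToSet hne) continuous_const
      filter_upwards [eventually_mem_of_limitMeasures_subset hopen
        (hx.trans fun μ hμ => hd.distToSet_lt_of_mem hμ hρ)] with n hn
      rw [Real.dist_eq, sub_zero, abs_of_nonneg (hd.distToSet_nonneg _ _)]
      exact hn
    -- Egorov's exceptional set is allowed measure at most `r`, less than the total, so its
    -- complement has positive measure.
    obtain ⟨r, hr0, hr⟩ : ∃ r : ℝ, 0 < r ∧ ENNReal.ofReal r < volume (univ : Set M) := by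
      obtain ⟨r, -, h0, h1⟩ := ENNReal.lt_iff_exists_real_btwn.1 (Measure.measure_univ_pos.2 hvol)
      exact ⟨r, ENNReal.ofReal_pos.1 h0, h1⟩
    obtain ⟨t, ht, hvt, hunif⟩ := tendstoUniformlyOn_of_ae_tendsto' (μ := (volume : Measure M))
      (fun n => (hcont n).stronglyMeasurable) stronglyMeasurable_const hlim hr0
    refine ⟨tᶜ, ht.compl, ?_, fun ρ hρ => ?_⟩
    · rw [pos_iff_ne_zero]
      intro h0
      have := measure_univ_le_add_compl t (μ := (volume : Measure M))
      rw [h0, add_zero] at this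
      exact absurd (this.trans hvt) (not_le.2 hr)
    · obtain ⟨N, hN⟩ := eventually_atTop.1 (Metric.tendstoUniformlyOn_iff.1 hunif (ρ / 2)
        (half_pos hρ))
      refine ⟨N, fun n hn => ?_⟩
      obtain ⟨ε₀, hε₀, h⟩ := hd.exists_dist_empiricStochastic_lt f n (half_pos hρ)
      refine ⟨ε₀, hε₀, fun ε hε hle x hx => ?_⟩
      have hx' := hN n hn x hx
      rw [Real.dist_eq, zero_sub, abs_neg] at hx'
      exact (hd.distToSet_lt_add hne (h ε hε hle x) ((le_abs_self _).trans_lt hx')).trans_eq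
        (add_halves ρ)
  -- The basin being full, the assumed inclusion makes the basin of `K` full as well.
  · intro K hK hKc _ h
    refine hd.pseudoPhysicalMeasures_subset f hKc.isClosed hK ?_
    filter_upwards [h, hbasin] with x hx hx'
    exact hx hx'

/-- A globally empirically stable set consists of the pseudo-physical measures. -/
theorem IsWeakStarMetric.eq_pseudoPhysicalMeasures (hd : IsWeakStarMetric d) {f : C(M, M)}
    {K : Set (ProbabilityMeasure M)} (h : IsGloballyEmpiricallyStable d f K) :
    K = pseudoPhysicalMeasures f := by
  have hsub := hd.pseudoPhysicalMeasures_subset f h.isCompact.isClosed h.nonempty h.basin_full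
  have hvol : (volume : Measure M) ≠ 0 := by
    obtain ⟨A, -, hA, -⟩ := h.approximates
    intro h0
    simp [h0] at hA
  have hglob := hd.isGloballyEmpiricallyStable hvol f
  refine (h.minimal _ hglob.nonempty hglob.isCompact hglob.subset_invariant ?_).antisymm hsub
  filter_upwards [hglob.basin_full] with x hx _ using hx

end ZeroNoise

/-! ### The mean ergodic theorem and recurrence -/

section MeanErgodic

variable {α : Type*} [MeasurableSpace α] {μ : Measure α} [IsProbabilityMeasure μ] {f : α → α}

omit [IsProbabilityMeasure μ] in
lemma integrable_comp_iterate (hf : MeasurePreserving f μ μ) {g : α → ℝ} (hg : Integrable g μ)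
    (n : ℕ) : Integrable (fun x => g (f^[n] x)) μ :=
  (hf.iterate n).integrable_comp_of_integrable hg

omit [IsProbabilityMeasure μ] in
lemma integrable_birkhoffAverage (hf : MeasurePreserving f μ μ) {g : α → ℝ} (hg : Integrable g μ)
    (n : ℕ) : Integrable (birkhoffAverage ℝ f g n) μ := by
  refine Integrable.smul (n : ℝ)⁻¹ (integrable_finsetSum _ fun k _ => ?_)
  exact integrable_comp_iterate hf hg k

omit [IsProbabilityMeasure μ] in
lemma integral_birkhoffAverage (hf : MeasurePreserving f μ μ) {g : α → ℝ} (hg : Integrable g μ)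
    {n : ℕ} (hn : n ≠ 0) : ∫ x, birkhoffAverage ℝ f g n x ∂μ = ∫ x, g x ∂μ := by
  have hint (k : ℕ) : ∫ x, g (f^[k] x) ∂μ = ∫ x, g x ∂μ := by
    have h := integral_map (μ := μ) (hf.iterate k).measurable.aemeasurable
      (f := g) (by rw [(hf.iterate k).map_eq]; exact hg.aestronglyMeasurable)
    rw [← h, (hf.iterate k).map_eq]
  simp only [birkhoffAverage, birkhoffSum, smul_eq_mul]
  rw [integral_const_mul, integral_finsetSum _
    fun k _ => integrable_comp_iterate hf hg k]
  simp only [hint, Finset.sum_const, Finset.card_range, nsmul_eq_mul]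
  have : (n : ℝ) ≠ 0 := by exact_mod_cast hn
  field_simp

/-- The mean ergodic theorem, with convergence in `L¹`, for ergodic maps. -/
theorem tendsto_integral_abs_birkhoffAverage_sub (h : Ergodic f μ) {g : α → ℝ}
    (hg : MemLp g 2 μ) : Tendsto
      (fun n : ℕ => ∫ x, |birkhoffAverage ℝ f g n x - ∫ y, g y ∂μ| ∂μ) atTop (𝓝 0) := by
  have hf : MeasurePreserving f μ μ := h.toMeasurePreserving
  have hgi : Integrable g μ := hg.integrable (by norm_num)
  let T : Lp ℝ 2 μ →L[ℝ] Lp ℝ 2 μ :=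
    (Lp.compMeasurePreservingₗᵢ ℝ f hf).toContinuousLinearMap
  have hT : ‖T‖ ≤ 1 := LinearIsometry.norm_toContinuousLinearMap_le _
  have hTapp (u : Lp ℝ 2 μ) : (T u : α → ℝ) =ᵐ[μ] u ∘ f := Lp.coeFn_compMeasurePreserving u hf
  have hiter (k : ℕ) : ((T^[k] (hg.toLp g) : Lp ℝ 2 μ) : α → ℝ) =ᵐ[μ] fun x => g (f^[k] x) := by
    induction k with
    | zero => exact hg.coeFn_toLp
    | succ k ih =>
      rw [Function.iterate_succ_apply']
      exact (hTapp _).trans (hf.quasiMeasurePreserving.ae_eq_comp ih)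
  have hsum (n : ℕ) : ((birkhoffSum T _root_.id n (hg.toLp g) : Lp ℝ 2 μ) : α → ℝ) =ᵐ[μ]
      birkhoffSum f g n := by
    induction n with
    | zero => simpa using Lp.coeFn_zero ℝ 2 μ
    | succ n ih =>
      rw [birkhoffSum_succ]
      filter_upwards [Lp.coeFn_add (birkhoffSum T _root_.id n (hg.toLp g))
        (T^[n] (hg.toLp g)), ih, hiter n] with x h1 h2 h3
      rw [birkhoffSum_succ, ← h2, ← h3]
      exact h1
  have havg (n : ℕ) : ((birkhoffAverage ℝ T _root_.id n (hg.toLp g) : Lp ℝ 2 μ) : α → ℝ) =ᵐ[μ]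
      birkhoffAverage ℝ f g n := by
    filter_upwards [Lp.coeFn_smul (n : ℝ)⁻¹ (birkhoffSum T _root_.id n (hg.toLp g)), hsum n]
      with x h1 h2
    rw [birkhoffAverage, birkhoffAverage, ← h2]
    exact h1
  -- Von Neumann's theorem in `L²` for the Koopman operator `T`. The limit `v` is `T`-invariant,
  -- hence almost everywhere a constant `c` by ergodicity; as averaging preserves the integral, `c`
  -- is the mean of `g`.
  have hlim := T.tendsto_birkhoffAverage_orthogonalProjection hT (hg.toLp g)
  set v : T.eqLocus (1 : Lp ℝ 2 μ →L[ℝ] Lp ℝ 2 μ) :=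
    (T.eqLocus (1 : Lp ℝ 2 μ →L[ℝ] Lp ℝ 2 μ)).orthogonalProjectionOnto (hg.toLp g)
  have hv : T (v : Lp ℝ 2 μ) = (v : Lp ℝ 2 μ) := v.2
  obtain ⟨c, hc⟩ := h.ae_eq_const_of_ae_eq_comp_ae (Lp.aestronglyMeasurable (v : Lp ℝ 2 μ))
    ((hTapp _).symm.trans (by rw [hv]))
  have hbound (n : ℕ) : ∫ x, |birkhoffAverage ℝ f g n x - c| ∂μ ≤
      ‖birkhoffAverage ℝ T _root_.id n (hg.toLp g) - (v : Lp ℝ 2 μ)‖ := by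
    set w := birkhoffAverage ℝ T _root_.id n (hg.toLp g) - (v : Lp ℝ 2 μ)
    have hw : (w : α → ℝ) =ᵐ[μ] fun x => birkhoffAverage ℝ f g n x - c := by
      filter_upwards [Lp.coeFn_sub (birkhoffAverage ℝ T _root_.id n (hg.toLp g)) (v : Lp ℝ 2 μ),
        havg n, hc] with x h1 h2 h3
      rw [h1, Pi.sub_apply, h2, h3, Function.const_apply]
    have h1 : ∫ x, |birkhoffAverage ℝ f g n x - c| ∂μ = ∫ x, ‖w x‖ ∂μ :=
      integral_congr_ae (hw.symm.mono fun x hx => by simp only [hx, Real.norm_eq_abs])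
    rw [h1, integral_norm_eq_lintegral_enorm (Lp.aestronglyMeasurable w),
      ← eLpNorm_one_eq_lintegral_enorm, Lp.norm_def]
    exact ENNReal.toReal_mono (Lp.eLpNorm_ne_top w)
      (eLpNorm_le_eLpNorm_of_exponent_le (by norm_num) (Lp.aestronglyMeasurable w))
  have hlim0 : Tendsto (fun n : ℕ => ∫ x, |birkhoffAverage ℝ f g n x - c| ∂μ) atTop (𝓝 0) :=
    squeeze_zero (fun n => integral_nonneg fun x => abs_nonneg _) hbound
      (tendsto_iff_norm_sub_tendsto_zero.1 hlim)
  have hceq : ∫ y, g y ∂μ = c := by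
    have hle : |∫ y, g y ∂μ - c| ≤ 0 := by
      refine ge_of_tendsto hlim0 ((eventually_ne_atTop 0).mono fun n hn => ?_)
      rw [← integral_birkhoffAverage hf hgi hn]
      have := abs_integral_le_integral_abs (f := fun x => birkhoffAverage ℝ f g n x - c) (μ := μ)
      rwa [integral_sub (integrable_birkhoffAverage hf hgi n) (integrable_const c),
        integral_const, probReal_univ, one_smul] at this
    exact sub_eq_zero.1 (abs_nonpos_iff.1 hle)
  rwa [hceq]

/-- A set of positive measure contains a point which returns to it at a time at which given
averages are close to their space means. -/
theorem exists_return_birkhoffAverage (h : Ergodic f μ) {U : Set α} (hU : MeasurableSet U)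
    (hU0 : μ U ≠ 0) {ι : Type*} (s : Finset ι) {g : ι → α → ℝ} (hg : ∀ i ∈ s, MemLp (g i) 2 μ)
    {τ : ℝ} (hτ : 0 < τ) : ∃ n : ℕ, n ≠ 0 ∧ ∃ x ∈ U, f^[n] x ∈ U ∧
      ∀ i ∈ s, |birkhoffAverage ℝ f (g i) n x - ∫ y, g i y ∂μ| < τ := by
  have hf : MeasurePreserving f μ μ := h.toMeasurePreserving
  -- If no such return exists, every point of `U ∩ f⁻ⁿ U` has a bad average, so by Markov's
  -- inequality `μ (U ∩ f⁻ⁿ U) → 0`. But ergodicity makes the Cesàro means of these measures tend to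
  -- `μ(U)² > 0`.
  by_contra! hcon
  have hle (n : ℕ) (hn : n ≠ 0) : μ.real (U ∩ f^[n] ⁻¹' U) ≤
      ∑ i ∈ s, τ⁻¹ * ∫ x, |birkhoffAverage ℝ f (g i) n x - ∫ y, g i y ∂μ| ∂μ := by
    have hsub : U ∩ f^[n] ⁻¹' U ⊆
        ⋃ i ∈ s, {x | τ ≤ |birkhoffAverage ℝ f (g i) n x - ∫ y, g i y ∂μ|} := by
      rintro x ⟨hx, hx'⟩
      obtain ⟨i, hi, hxi⟩ := hcon n hn x hx hx'
      exact mem_iUnion₂.2 ⟨i, hi, hxi⟩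
    refine (measureReal_mono hsub (measure_ne_top _ _)).trans
      ((measureReal_biUnion_finset_le _ _).trans (Finset.sum_le_sum fun i hi => ?_))
    rw [le_inv_mul_iff₀ hτ]
    refine mul_meas_ge_le_integral_of_nonneg (.of_forall fun x => abs_nonneg _) ?_ τ
    exact ((integrable_birkhoffAverage hf ((hg i hi).integrable (by norm_num)) n).sub
      (integrable_const _)).abs
  have hlim0 : Tendsto (fun n : ℕ => μ.real (U ∩ f^[n] ⁻¹' U)) atTop (𝓝 0) := by
    have hsum : Tendsto (fun n : ℕ => ∑ i ∈ s,
        τ⁻¹ * ∫ x, |birkhoffAverage ℝ f (g i) n x - ∫ y, g i y ∂μ| ∂μ) atTop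
        (𝓝 (∑ i ∈ s, τ⁻¹ * 0)) :=
      tendsto_finsetSum _ fun i hi =>
        (tendsto_integral_abs_birkhoffAverage_sub h (hg i hi)).const_mul _
    simp only [mul_zero, Finset.sum_const_zero] at hsum
    exact squeeze_zero' (.of_forall fun n => measureReal_nonneg)
      ((eventually_ne_atTop 0).mono hle) hsum
  have hind : MemLp (U.indicator fun _ => (1 : ℝ)) 2 μ :=
    memLp_indicator_const 2 hU 1 (Or.inr (measure_ne_top μ U))
  have hindi : Integrable (U.indicator fun _ => (1 : ℝ)) μ := hind.integrable (by norm_num)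
  have hmean : ∫ y, U.indicator (fun _ => (1 : ℝ)) y ∂μ = μ.real U := by
    rw [integral_indicator_const _ hU, smul_eq_mul, mul_one]
  have hces (n : ℕ) : ∫ x in U, birkhoffAverage ℝ f (U.indicator fun _ => (1 : ℝ)) n x ∂μ =
      (n : ℝ)⁻¹ * ∑ k ∈ Finset.range n, μ.real (U ∩ f^[k] ⁻¹' U) := by
    simp only [birkhoffAverage, birkhoffSum, smul_eq_mul]
    rw [integral_const_mul, integral_finsetSum _
      fun k _ => (integrable_comp_iterate hf hindi k).integrableOn]
    congr 1
    refine Finset.sum_congr rfl fun k _ => ?_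
    have hm : MeasurableSet (f^[k] ⁻¹' U) := (hf.iterate k).measurable hU
    have : (fun x => U.indicator (fun _ => (1 : ℝ)) (f^[k] x)) =
        (f^[k] ⁻¹' U).indicator fun _ => (1 : ℝ) := rfl
    rw [this, integral_indicator_const _ hm, smul_eq_mul, mul_one,
      measureReal_restrict_apply hm, inter_comm]
  have hlim1 : Tendsto (fun n : ℕ => (n : ℝ)⁻¹ * ∑ k ∈ Finset.range n, μ.real (U ∩ f^[k] ⁻¹' U))
      atTop (𝓝 (μ.real U * μ.real U)) := by
    refine tendsto_iff_norm_sub_tendsto_zero.2 (squeeze_zero (fun n => norm_nonneg _) (fun n => ?_)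
      (tendsto_integral_abs_birkhoffAverage_sub h hind))
    have hint := (integrable_birkhoffAverage hf hindi n).sub (integrable_const (μ.real U))
    have h1 : ∫ x in U, (birkhoffAverage ℝ f (U.indicator fun _ => (1 : ℝ)) n x - μ.real U) ∂μ =
        (n : ℝ)⁻¹ * ∑ k ∈ Finset.range n, μ.real (U ∩ f^[k] ⁻¹' U) - μ.real U * μ.real U := by
      rw [integral_sub (integrable_birkhoffAverage hf hindi n).integrableOn (integrable_const _),
        hces, setIntegral_const, smul_eq_mul]
    rw [← h1, hmean]
    exact (norm_integral_le_integral_norm _).trans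
      (setIntegral_le_integral hint.norm (.of_forall fun x => norm_nonneg _))
  have heq := tendsto_nhds_unique hlim1 hlim0.cesaro
  have hpos : μ.real U ≠ 0 := by
    rw [Measure.real, ENNReal.toReal_ne_zero]
    exact ⟨hU0, measure_ne_top μ U⟩
  exact hpos (mul_self_eq_zero.1 heq)

end MeanErgodic

/-! ### Trapping sets and pseudo-physical measures -/

section Trapping

variable {M : Type*} [MetricSpace M] [CompactSpace M] [MeasureSpace M] [BorelSpace M]

/-- The empirical measure starts at time `1` and Birkhoff averages at time `0`, whence `φ ∘ f`. -/
lemma integral_empiricalMeasure_eq_birkhoffAverage (f : C(M, M)) (n : ℕ+) (x : M) (φ : C(M, ℝ)) :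
    ∫ y, φ y ∂(empiricalMeasure f n x : Measure M) = birkhoffAverage ℝ f (φ ∘ f) n x := by
  rw [integral_empiricalMeasure, birkhoffAverage, birkhoffSum, smul_eq_mul,
    ← Finset.Ico_add_one_right_eq_Icc, Finset.sum_Ico_eq_sum_range]
  simp only [Nat.add_sub_cancel, Function.comp_apply, add_comm 1, Function.iterate_succ_apply']

omit [MetricSpace M] [CompactSpace M] [MeasureSpace M] [BorelSpace M] in
-- Cut the orbit into blocks of length `p`, each starting in `J`: a full block contributes at most
-- `p * κ`, and the one incomplete block at most `p * B`.
lemma abs_birkhoffSum_sub_le {f : M → M} {ψ : M → ℝ} {J : Set M} {p : ℕ} (hp : p ≠ 0)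
    (hJ : ∀ x ∈ J, f^[p] x ∈ J) {q κ B : ℝ} (hB : ∀ x, |ψ x - q| ≤ B)
    (havg : ∀ x ∈ J, |birkhoffAverage ℝ f ψ p x - q| ≤ κ) (n : ℕ) :
    ∀ x ∈ J, |birkhoffSum f ψ n x - n * q| ≤ n * κ + p * B := by
  induction n using Nat.strong_induction_on with
  | _ n ih =>
    intro x hx
    have hκ : 0 ≤ κ := (abs_nonneg _).trans (havg x hx)
    have hB0 : 0 ≤ B := (abs_nonneg _).trans (hB x)
    rcases lt_or_ge n p with hn | hn
    · have h1 : birkhoffSum f ψ n x - n * q = ∑ k ∈ Finset.range n, (ψ (f^[k] x) - q) := by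
        simp [birkhoffSum, Finset.sum_sub_distrib]
      have h2 : |birkhoffSum f ψ n x - n * q| ≤ ∑ k ∈ Finset.range n, B := by
        rw [h1]
        exact (Finset.abs_sum_le_sum_abs _ _).trans (Finset.sum_le_sum fun k _ => hB _)
      have h3 : (n : ℝ) * B ≤ p * B := by gcongr
      have h4 : 0 ≤ (n : ℝ) * κ := by positivity
      simp only [Finset.sum_const, Finset.card_range, nsmul_eq_mul] at h2
      linarith
    · obtain ⟨m, rfl⟩ := Nat.exists_eq_add_of_le hn
      have h1 := ih m (by omega) _ (hJ x hx)
      have hp0 : (0 : ℝ) < p := by exact_mod_cast Nat.pos_of_ne_zero hp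
      have h2 : |birkhoffSum f ψ p x - p * q| ≤ p * κ := by
        have : birkhoffSum f ψ p x - p * q = p * (birkhoffAverage ℝ f ψ p x - q) := by
          rw [birkhoffAverage, smul_eq_mul]
          field_simp
        rw [this, abs_mul, abs_of_pos hp0]
        gcongr
        exact havg x hx
      have h3 : birkhoffSum f ψ (p + m) x - (p + m : ℕ) * q =
          (birkhoffSum f ψ p x - p * q) + (birkhoffSum f ψ m (f^[p] x) - m * q) := by
        rw [birkhoffSum_add]
        push_cast
        ring
      rw [h3]
      refine (abs_add_le _ _).trans ((add_le_add h2 h1).trans (le_of_eq ?_))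
      push_cast
      ring

lemma abs_integral_sub_le_of_mem_limitMeasures {f : C(M, M)} {φ : C(M, ℝ)} {J : Set M} {p : ℕ}
    (hp : p ≠ 0) (hJ : ∀ x ∈ J, f^[p] x ∈ J) {q κ : ℝ}
    (havg : ∀ x ∈ J, |birkhoffAverage ℝ f (φ ∘ f) p x - q| ≤ κ) {x : M} (hx : x ∈ J)
    {ν : ProbabilityMeasure M} (hν : ν ∈ limitMeasures f x) :
    |∫ y, φ y ∂(ν : Measure M) - q| ≤ κ := by
  have hB : ∀ y, |(φ ∘ f) y - q| ≤ ‖φ‖ + |q| := fun y =>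
    (abs_sub _ _).trans (by gcongr; exact φ.norm_coe_le_norm (f y))
  refine le_of_forall_pos_le_add fun δ hδ => ?_
  refine mem_of_mem_limitMeasures hν (isClosed_le
    ((continuous_integral φ).sub continuous_const).abs (continuous_const (y := κ + δ))) ?_
  have hlim := tendsto_inv_pnat_atTop.mul_const (p * (‖φ‖ + |q|))
  rw [zero_mul] at hlim
  filter_upwards [hlim.eventually (gt_mem_nhds hδ)] with n hn
  have hn0 : (0 : ℝ) < (n : ℕ) := by exact_mod_cast n.pos
  have h1 := abs_birkhoffSum_sub_le hp hJ hB havg n x hx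
  have h2 : birkhoffAverage ℝ f (φ ∘ f) n x - q =
      ((n : ℕ) : ℝ)⁻¹ * (birkhoffSum f (φ ∘ f) n x - n * q) := by
    rw [birkhoffAverage, smul_eq_mul]
    field_simp
  change |∫ y, φ y ∂(empiricalMeasure f n x : Measure M) - q| ≤ κ + δ
  rw [integral_empiricalMeasure_eq_birkhoffAverage, h2, abs_mul, abs_of_pos (inv_pos.2 hn0)]
  calc ((n : ℕ) : ℝ)⁻¹ * |birkhoffSum f (φ ∘ f) n x - n * q|
      ≤ ((n : ℕ) : ℝ)⁻¹ * (n * κ + p * (‖φ‖ + |q|)) := by gcongr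
    _ = κ + ((n : ℕ) : ℝ)⁻¹ * (p * (‖φ‖ + |q|)) := by field_simp
    _ ≤ κ + δ := by gcongr

omit [CompactSpace M] [MeasureSpace M] [BorelSpace M] in
lemma continuous_iterate_apply [LocallyCompactSpace M] (n : ℕ) :
    Continuous fun p : C(M, M) × M => p.1^[n] p.2 := by
  induction n with
  | zero => exact continuous_snd
  | succ n ih =>
    simp only [Function.iterate_succ_apply']
    exact continuous_fst.eval ih

omit [CompactSpace M] [MeasureSpace M] [BorelSpace M] in
lemma continuous_birkhoffAverage_apply [LocallyCompactSpace M] (φ : C(M, ℝ)) (n : ℕ) :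
    Continuous fun p : C(M, M) × M => birkhoffAverage ℝ p.1 (φ ∘ p.1) n p.2 := by
  simp only [birkhoffAverage, birkhoffSum, Function.comp_apply, smul_eq_mul,
    ← Function.iterate_succ_apply']
  exact continuous_const.mul (continuous_finsetSum _ fun k _ =>
    φ.continuous.comp (continuous_iterate_apply (k + 1)))

/-- The maps with a trapping set, periodic in the sense that some iterate maps it into its
interior, along which the averages of the functions `φ k` over the period are `κ`-close to `q k`. -/
def mapsTrappingNear {ι : Type*} (φ : ι → C(M, ℝ)) (q : ι → ℝ) (κ : ℝ) : Set C(M, M) :=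
  {f | ∃ p : ℕ, p ≠ 0 ∧ ∃ J : Set M, IsCompact J ∧ J.Nonempty ∧ ∀ x ∈ J,
    f^[p] x ∈ interior J ∧ ∀ k, |birkhoffAverage ℝ f (φ k ∘ f) p x - q k| < κ}

omit [MeasureSpace M] [BorelSpace M] in
-- The same `p` and `J` work for nearby maps: the conditions are finitely many, open in `(f, x)`,
-- and `J` is compact.
lemma isOpen_mapsTrappingNear {ι : Type*} [Finite ι] (φ : ι → C(M, ℝ)) (q : ι → ℝ) (κ : ℝ) :
    IsOpen (mapsTrappingNear φ q κ) := by
  refine isOpen_iff_mem_nhds.2 fun f hf => ?_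
  obtain ⟨p, hp, J, hJ, hne, h⟩ := hf
  have hev : ∀ᶠ g : C(M, M) in 𝓝 f, ∀ x ∈ J, g^[p] x ∈ interior J ∧
      ∀ k, |birkhoffAverage ℝ g (φ k ∘ g) p x - q k| < κ := by
    refine hJ.eventually_forall_of_forall_eventually fun x hx => ?_
    refine Filter.Eventually.and ?_ (eventually_all.2 fun k => ?_)
    · exact (continuous_iterate_apply p).continuousAt (x := (f, x))
        (isOpen_interior.mem_nhds (h x hx).1)
    · exact ((continuous_birkhoffAverage_apply (φ k) p).sub continuous_const).abs.continuousAt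
        (x := (f, x)) (gt_mem_nhds ((h x hx).2 k))
  exact hev.mono fun g hg => ⟨p, hp, J, hJ, hne, hg⟩

/-- The interior of `J` has positive measure, so it contains a point all of whose limit measures are
pseudo-physical. -/
lemma exists_pseudoPhysicalMeasure_of_mem_mapsTrappingNear [(volume : Measure M).IsOpenPosMeasure]
    {ι : Type*} {φ : ι → C(M, ℝ)} {q : ι → ℝ} {κ : ℝ} {f : C(M, M)}
    (hf : f ∈ mapsTrappingNear φ q κ) :
    ∃ ν ∈ pseudoPhysicalMeasures f, ∀ k, |∫ y, φ k y ∂(ν : Measure M) - q k| ≤ κ := by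
  obtain ⟨p, hp, J, -, ⟨y, hy⟩, h⟩ := hf
  have hvol : volume (interior J) ≠ 0 := isOpen_interior.measure_ne_zero volume ⟨_, (h y hy).1⟩
  obtain ⟨x, hxJ, hx⟩ : ∃ x ∈ J, limitMeasures f x ⊆ pseudoPhysicalMeasures f := by
    by_contra! hcon
    exact hvol (measure_mono_null (fun x hx => hcon x (interior_subset hx))
      (ae_iff.1 (ae_limitMeasures_subset f)))
  obtain ⟨ν, hν⟩ := limitMeasures_nonempty f x
  exact ⟨ν, hx hν, fun k => abs_integral_sub_le_of_mem_limitMeasures hp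
    (fun z hz => interior_subset (h z hz).1) (fun z hz => ((h z hz).2 k).le) hxJ hν⟩

omit [MeasureSpace M] [BorelSpace M] in
lemma continuous_integral_left [MeasurableSpace M] [BorelSpace M] (μ : ProbabilityMeasure M) :
    Continuous fun φ : C(M, ℝ) => ∫ y, φ y ∂(μ : Measure M) := by
  refine (LipschitzWith.of_dist_le_mul (K := 1) fun φ ψ => ?_).continuous
  rw [NNReal.coe_one, one_mul, dist_eq_norm, dist_eq_norm,
    ← integral_sub (integrable_continuousMap φ _) (integrable_continuousMap ψ _)]
  have := norm_integral_le_of_norm_le_const (μ := (μ : Measure M))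
    (.of_forall fun y => (φ - ψ).norm_coe_le_norm y)
  simpa using this

/-- A closed set of measures contains every measure which it approximates on each finite set of
functions of a dense sequence. -/
lemma mem_of_forall_exists_abs_integral_sub_le {φ : ℕ → C(M, ℝ)} (hφ : DenseRange φ)
    {K : Set (ProbabilityMeasure M)} (hK : IsClosed K) {μ : ProbabilityMeasure M} {C : ℝ}
    (h : ∀ N : ℕ, ∃ ν ∈ K, ∀ k < N, |∫ y, φ k y ∂(ν : Measure M) - ∫ y, φ k y ∂(μ : Measure M)| ≤
      C * ((N : ℝ) + 1)⁻¹) : μ ∈ K := by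
  choose ν hνK hν using h
  obtain ⟨κ, hκK, hκ⟩ := hK.isCompact.exists_mapClusterPt (f := atTop) (u := ν)
    (tendsto_principal.2 (.of_forall hνK))
  have heq (k : ℕ) : ∫ y, φ k y ∂(κ : Measure M) = ∫ y, φ k y ∂(μ : Measure M) := by
    have hlim : Tendsto (fun N => ∫ y, φ k y ∂(ν N : Measure M)) atTop
        (𝓝 (∫ y, φ k y ∂(μ : Measure M))) := by
      refine tendsto_iff_norm_sub_tendsto_zero.2 (squeeze_zero' (.of_forall fun N => norm_nonneg _)
        ((eventually_gt_atTop k).mono fun N hN => hν N k hN) ?_)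
      have := (tendsto_one_div_add_atTop_nhds_zero_nat (𝕜 := ℝ)).const_mul C
      simpa using this
    exact eq_of_nhds_neBot (NeBot.mono
      (hκ.continuousAt_comp (continuous_integral (φ k)).continuousAt)
      (inf_le_inf_left _ hlim))
  have : κ = μ := eq_of_forall_integral_eq fun ψ => congr_fun
    (hφ.equalizer (continuous_integral_left κ) (continuous_integral_left μ) (funext heq)) ψ
  exact this ▸ hκK

/-- The maps with two disjoint trapping sets. -/
def mapsTwoTrapping (M : Type*) [MetricSpace M] : Set C(M, M) :=
  {f | ∃ J J' : Set M, IsCompact J ∧ IsCompact J' ∧ J.Nonempty ∧ J'.Nonempty ∧ Disjoint J J' ∧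
    MapsTo f J (interior J) ∧ MapsTo f J' (interior J')}

omit [CompactSpace M] [MeasureSpace M] [BorelSpace M] in
lemma isOpen_mapsTwoTrapping : IsOpen (mapsTwoTrapping M) := by
  refine isOpen_iff_mem_nhds.2 fun f hf => ?_
  obtain ⟨J, J', hJ, hJ', hne, hne', hdisj, h, h'⟩ := hf
  filter_upwards [ContinuousMap.eventually_mapsTo hJ isOpen_interior h,
    ContinuousMap.eventually_mapsTo hJ' isOpen_interior h'] with g hg hg'
  exact ⟨J, J', hJ, hJ', hne, hne', hdisj, hg, hg'⟩

/-- Only the first `j₀` terms of the averages can differ from `c`. -/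
lemma integral_eq_of_mem_limitMeasures {f : C(M, M)} {ψ : C(M, ℝ)} {x : M} {c : ℝ} {j₀ : ℕ}
    (h : ∀ j, ψ (f (f^[j] (f^[j₀] x))) = c) {ν : ProbabilityMeasure M}
    (hν : ν ∈ limitMeasures f x) : ∫ y, ψ y ∂(ν : Measure M) = c := by
  have hlim : Tendsto (fun n : ℕ+ => ∫ y, ψ y ∂(empiricalMeasure f n x : Measure M)) atTop
      (𝓝 c) := by
    have hB : ∀ y, |(ψ ∘ f) y - c| ≤ ‖ψ‖ + |c| := fun y =>
      (abs_sub _ _).trans (by gcongr; exact ψ.norm_coe_le_norm (f y))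
    have hb (n : ℕ+) : ‖∫ y, ψ y ∂(empiricalMeasure f n x : Measure M) - c‖ ≤
        ((n : ℕ) : ℝ)⁻¹ * (j₀ * (‖ψ‖ + |c|)) := by
      have hn0 : (0 : ℝ) < (n : ℕ) := by exact_mod_cast n.pos
      have h2 : birkhoffAverage ℝ f (ψ ∘ f) n x - c =
          ((n : ℕ) : ℝ)⁻¹ * ∑ k ∈ Finset.range n, ((ψ ∘ f) (f^[k] x) - c) := by
        rw [birkhoffAverage, birkhoffSum, smul_eq_mul, Finset.sum_sub_distrib]
        simp only [Finset.sum_const, Finset.card_range, nsmul_eq_mul]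
        field_simp
      rw [integral_empiricalMeasure_eq_birkhoffAverage, h2, Real.norm_eq_abs, abs_mul,
        abs_of_pos (inv_pos.2 hn0)]
      gcongr
      refine (Finset.abs_sum_le_sum_abs _ _).trans ?_
      have h3 : ∑ k ∈ Finset.range n, |(ψ ∘ f) (f^[k] x) - c| ≤
          ∑ k ∈ Finset.range n, if k < j₀ then (‖ψ‖ + |c|) else 0 := by
        refine Finset.sum_le_sum fun k _ => ?_
        split_ifs with hk
        · exact hB _
        · obtain ⟨i, rfl⟩ := Nat.exists_eq_add_of_le' (not_lt.1 hk)
          rw [Function.iterate_add_apply, Function.comp_apply, h i, sub_self, abs_zero]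
      refine h3.trans ?_
      rw [← Finset.sum_filter, Finset.sum_const, nsmul_eq_mul]
      gcongr
      refine (Finset.card_le_card (t := Finset.range j₀) fun k hk => ?_).trans_eq
        (Finset.card_range j₀)
      simpa using (Finset.mem_filter.1 hk).2
    have hlim0 := tendsto_inv_pnat_atTop.mul_const (j₀ * (‖ψ‖ + |c|))
    rw [zero_mul] at hlim0
    exact tendsto_iff_norm_sub_tendsto_zero.2
      (squeeze_zero (fun n => norm_nonneg _) hb hlim0)
  exact eq_of_nhds_neBot (NeBot.mono
    (MapClusterPt.continuousAt_comp (continuous_integral ψ).continuousAt hν)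
    (inf_le_inf_left _ hlim))

omit [CompactSpace M] [MeasureSpace M] [BorelSpace M] in
lemma mapsTo_iterate_of_mapsTo_interior {f : C(M, M)} {J : Set M} (h : MapsTo f J (interior J))
    (j : ℕ) : MapsTo f^[j] J J :=
  (h.mono_right interior_subset).iterate j

/-- Two disjoint trapping sets are separated by a function whose integral takes only the values
`0` and `1` on the pseudo-physical measures, and both of them on the invariant measures. -/
lemma exists_integral_eq_zero_or_one {f : C(M, M)} (hf : f ∈ mapsTwoTrapping M) :
    ∃ ψ : C(M, ℝ), (∀ ν ∈ pseudoPhysicalMeasures f,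
        ∫ y, ψ y ∂(ν : Measure M) = 0 ∨ ∫ y, ψ y ∂(ν : Measure M) = 1) ∧
      (∃ ν ∈ invariantMeasures f, ∫ y, ψ y ∂(ν : Measure M) = 0) ∧
      ∃ ν ∈ invariantMeasures f, ∫ y, ψ y ∂(ν : Measure M) = 1 := by
  obtain ⟨J, J', hJ, hJ', ⟨a, ha⟩, ⟨b, hb⟩, hdisj, h, h'⟩ := hf
  -- Urysohn: `ψ` is `1` on `f '' J` and `0` off the interior of `J`. An orbit that enters `J`
  -- eventually sees only the value `1`; one that never does sees only `0`.
  obtain ⟨ψ, hψ0, hψ1, -⟩ := exists_continuous_zero_one_of_isClosed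
    (s := (interior J)ᶜ) (t := f '' J) isOpen_interior.isClosed_compl
    (hJ.image f.continuous).isClosed (disjoint_compl_left_iff_subset.2 h.image_subset)
  have h1 (x : M) (j₀ : ℕ) (hx : f^[j₀] x ∈ J) (ν : ProbabilityMeasure M)
      (hν : ν ∈ limitMeasures f x) : ∫ y, ψ y ∂(ν : Measure M) = 1 :=
    integral_eq_of_mem_limitMeasures (j₀ := j₀)
      (fun j => hψ1 (mem_image_of_mem f (mapsTo_iterate_of_mapsTo_interior h j hx))) hν
  have h0 (x : M) (hx : ∀ j, f^[j] x ∉ J) (ν : ProbabilityMeasure M)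
      (hν : ν ∈ limitMeasures f x) : ∫ y, ψ y ∂(ν : Measure M) = 0 := by
    refine integral_eq_of_mem_limitMeasures (j₀ := 0) (fun j => hψ0 fun hmem => ?_) hν
    rw [← Function.iterate_succ_apply' f] at hmem
    exact hx _ (interior_subset hmem)
  refine ⟨ψ, ?_, ?_, ?_⟩
  · have hclosed : IsClosed {ν : ProbabilityMeasure M |
        ∫ y, ψ y ∂(ν : Measure M) = 0 ∨ ∫ y, ψ y ∂(ν : Measure M) = 1} :=
      (isClosed_eq (continuous_integral ψ) continuous_const).union
        (isClosed_eq (continuous_integral ψ) continuous_const)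
    refine essentialRange_subset hclosed (.of_forall fun x ν hν => ?_)
    by_cases hx : ∃ j, f^[j] x ∈ J
    · exact Or.inr (h1 x hx.choose hx.choose_spec ν hν)
    · exact Or.inl (h0 x (not_exists.1 hx) ν hν)
  · obtain ⟨ν, hν⟩ := limitMeasures_nonempty f b
    exact ⟨ν, limitMeasures_subset_invariantMeasures f b hν, h0 b (fun j hj =>
      disjoint_left.1 hdisj hj (mapsTo_iterate_of_mapsTo_interior h' j hb)) ν hν⟩
  · obtain ⟨ν, hν⟩ := limitMeasures_nonempty f a
    exact ⟨ν, limitMeasures_subset_invariantMeasures f a hν, h1 a 0 ha ν hν⟩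

/-- The convex combination of two probability measures. -/
noncomputable def mixture (μ ν : ProbabilityMeasure M) (t : I) : ProbabilityMeasure M :=
  ⟨ENNReal.ofReal (1 - t) • (μ : Measure M) + ENNReal.ofReal t • (ν : Measure M), by
    constructor
    simp only [Measure.add_apply, Measure.smul_apply, measure_univ, smul_eq_mul, mul_one]
    rw [← ENNReal.ofReal_add (sub_nonneg.2 t.2.2) t.2.1, sub_add_cancel, ENNReal.ofReal_one]⟩

lemma integral_mixture (μ ν : ProbabilityMeasure M) (t : I) (φ : C(M, ℝ)) :
    ∫ y, φ y ∂(mixture μ ν t : Measure M) =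
      (1 - t) * ∫ y, φ y ∂(μ : Measure M) + t * ∫ y, φ y ∂(ν : Measure M) := by
  rw [mixture, ProbabilityMeasure.coe_mk, integral_add_measure
    ((integrable_continuousMap φ _).smul_measure ENNReal.ofReal_ne_top)
    ((integrable_continuousMap φ _).smul_measure ENNReal.ofReal_ne_top),
    integral_smul_measure, integral_smul_measure, ENNReal.toReal_ofReal (sub_nonneg.2 t.2.2),
    ENNReal.toReal_ofReal t.2.1, smul_eq_mul, smul_eq_mul]

lemma continuous_mixture (μ ν : ProbabilityMeasure M) : Continuous (mixture μ ν) := by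
  refine continuous_iff_continuousAt.2 fun t => tendsto_iff_forall_continuousMap.2 fun φ => ?_
  simp only [integral_mixture]
  exact Continuous.tendsto (by fun_prop) t

lemma mixture_mem_invariantMeasures {f : C(M, M)} {μ ν : ProbabilityMeasure M}
    (hμ : μ ∈ invariantMeasures f) (hν : ν ∈ invariantMeasures f) (t : I) :
    mixture μ ν t ∈ invariantMeasures f := by
  have h {κ : ProbabilityMeasure M} (hκ : κ ∈ invariantMeasures f) (φ : C(M, ℝ)) :
      ∫ y, (φ.comp f) y ∂(κ : Measure M) = ∫ y, φ y ∂(κ : Measure M) := by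
    have := integral_map (μ := (κ : Measure M)) f.continuous.measurable.aemeasurable
      φ.continuous.aestronglyMeasurable
    rw [MeasurePreserving.map_eq hκ] at this
    exact this.symm
  refine mem_invariantMeasures_of_integral fun φ => ?_
  change ∫ y, (φ.comp f) y ∂(mixture μ ν t : Measure M) = _
  rw [integral_mixture, integral_mixture, h hμ, h hν]

/-- With two disjoint trapping sets, the pseudo-physical measures have empty interior in the space
of invariant measures. -/
theorem interior_pseudoPhysicalMeasures_eq_empty {f : C(M, M)} (hf : f ∈ mapsTwoTrapping M) :
    interior {μ : invariantMeasures f | (μ : ProbabilityMeasure M) ∈ pseudoPhysicalMeasures f} =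
      ∅ := by
  obtain ⟨ψ, hψ, ⟨ν₀, hν₀, h0⟩, ν₁, hν₁, h1⟩ := exists_integral_eq_zero_or_one hf
  refine eq_empty_iff_forall_notMem.2 fun μ hμ => ?_
  have hcon {ν : ProbabilityMeasure M} (hν : ν ∈ invariantMeasures f) :
      ∃ t : I, 0 < t ∧ t < 1 ∧ mixture (μ : ProbabilityMeasure M) ν t ∈
        pseudoPhysicalMeasures f := by
    let γ : I → invariantMeasures f := fun t => ⟨mixture μ ν t,
      mixture_mem_invariantMeasures μ.2 hν t⟩
    have hγ : Continuous γ := (continuous_mixture _ _).subtype_mk _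
    have hγ0 : γ 0 = μ := by
      apply Subtype.ext
      refine eq_of_forall_integral_eq fun φ => ?_
      change ∫ y, φ y ∂(mixture (μ : ProbabilityMeasure M) ν 0 : Measure M) = _
      rw [integral_mixture]
      simp
    have hmem : ∀ᶠ t in 𝓝[≠] (0 : I), γ t ∈ {μ : invariantMeasures f |
        (μ : ProbabilityMeasure M) ∈ pseudoPhysicalMeasures f} := by
      refine mem_nhdsWithin_of_mem_nhds (hγ.continuousAt.eventually ?_)
      rw [hγ0]
      exact mem_interior_iff_mem_nhds.1 hμ
    obtain ⟨t, ht, ht0, ht1⟩ := (hmem.and (eventually_mem_nhdsWithin.and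
      (mem_nhdsWithin_of_mem_nhds (gt_mem_nhds zero_lt_one)))).exists
    exact ⟨t, unitInterval.pos_iff_ne_zero.2 ht0, ht1, ht⟩
  -- Moving from `μ` slightly towards a measure with the other value gives an integral strictly
  -- between `0` and `1`.
  rcases hψ μ (show μ ∈ _ from interior_subset hμ) with hμ0 | hμ1
  · obtain ⟨t, ht0, ht1, ht⟩ := hcon hν₁
    have ht0' : (0 : ℝ) < t := ht0
    have ht1' : (t : ℝ) < 1 := ht1
    have := hψ _ ht
    rw [integral_mixture, hμ0, h1] at this
    rcases this with h | h <;> linarith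
  · obtain ⟨t, ht0, ht1, ht⟩ := hcon hν₀
    have ht0' : (0 : ℝ) < t := ht0
    have ht1' : (t : ℝ) < 1 := ht1
    have := hψ _ ht
    rw [integral_mixture, hμ1, h0] at this
    rcases this with h | h <;> linarith

end Trapping

/-! ### Closing orbits by perturbing interval maps -/

section Perturbation

lemma dist_convexCombination_lt {a b c η : ℝ} (hb : dist b a < η) (hc : dist c a < η) {u : ℝ}
    (hu0 : 0 ≤ u) (hu1 : u ≤ 1) : dist ((1 - u) * b + u * c) a < η :=
  convex_ball a η hb hc (sub_nonneg.2 hu1) hu0 (by ring)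

/-- A map of the interval may be perturbed to be constant near finitely many points, with any
values close to the original ones. -/
lemma exists_eventually_eq_const (f : C(I, I)) {η : ℝ} (hη : 0 < η) {ι : Type*} (s : Finset ι)
    {y t : ι → I} (hy : InjOn y s) (h : ∀ i ∈ s, dist (t i) (f (y i)) < η) :
    ∃ g : C(I, I), (∀ x, dist (g x) (f x) < η) ∧ ∀ i ∈ s, ∀ᶠ x in 𝓝 (y i), g x = t i := by
  classical
  induction s using Finset.induction_on with
  | empty => exact ⟨f, by simpa using hη, by simp⟩
  | insert a s ha ih =>
    obtain ⟨g, hg, hgs⟩ := ih (hy.mono (by simp)) fun i hi => h i (Finset.mem_insert_of_mem hi)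
    have hnear : ∀ᶠ x in 𝓝 (y a), dist (t a) (f x) < η ∧ ∀ i ∈ s, x ≠ y i := by
      refine ((continuous_const.dist f.continuous).continuousAt.eventually
        (gt_mem_nhds (h a (Finset.mem_insert_self a s)))).and
        ((Finset.eventually_all s).2 fun i hi => isOpen_ne.mem_nhds fun hai => ha ?_)
      rwa [hy (by simp) (by simp [hi]) hai]
    obtain ⟨r, hr, hball⟩ := Metric.nhds_basis_closedBall.mem_iff.1 hnear
    -- A bump equal to `1` on the ball of radius `r / 2` and to `0` outside radius `r`. Where it is
    -- active, both `g x` and `t a` are within `η` of `f x`, and hence so is their convex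
    -- combination.
    let u : I → ℝ := fun x => max 0 (min 1 (2 - 2 / r * dist x (y a)))
    have hu0 (x : I) : 0 ≤ u x := le_max_left _ _
    have hu1 (x : I) : u x ≤ 1 := max_le zero_le_one (min_le_left _ _)
    have huc : Continuous u := by fun_prop
    have hur {x : I} (hx : x ∉ Metric.closedBall (y a) r) : u x = 0 := by
      rw [Metric.mem_closedBall, not_le] at hx
      refine max_eq_left ((min_le_right _ _).trans ?_)
      have : 2 / r * r ≤ 2 / r * dist x (y a) := by gcongr
      rw [div_mul_cancel₀ _ hr.ne'] at this
      linarith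
    let g' : C(I, I) := ⟨fun x => ⟨(1 - u x) * g x + u x * t a,
      convex_Icc (0 : ℝ) 1 (g x).2 (t a).2 (sub_nonneg.2 (hu1 x)) (hu0 x) (by ring)⟩,
      Continuous.subtype_mk (by fun_prop) _⟩
    have hg'0 {x : I} (hx : u x = 0) : g' x = g x := by
      apply Subtype.ext
      change (1 - u x) * (g x : ℝ) + u x * t a = g x
      rw [hx]
      ring
    refine ⟨g', fun x => ?_, fun i hi => ?_⟩
    · by_cases hx : x ∈ Metric.closedBall (y a) r
      · exact dist_convexCombination_lt (hg x) (hball hx).1 (hu0 x) (hu1 x)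
      · rw [hg'0 (hur hx)]
        exact hg x
    · rcases Finset.mem_insert.1 hi with rfl | his
      · filter_upwards [Metric.ball_mem_nhds (y i) (half_pos hr)] with x hx
        have hux : u x = 1 := by
          refine (max_eq_right (le_min zero_le_one ?_)).trans (min_eq_left ?_) <;>
          · have : 2 / r * dist x (y i) ≤ 2 / r * (r / 2) := by
              gcongr
              exact (Metric.mem_ball.1 hx).le
            rw [div_mul_div_cancel₀' two_ne_zero, div_self hr.ne'] at this
            linarith
        apply Subtype.ext
        change (1 - u x) * (g x : ℝ) + u x * t i = t i
        rw [hux]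
        ring
      · have hmem : y i ∈ (Metric.closedBall (y a) r)ᶜ := fun hmem => (hball hmem).2 i his rfl
        filter_upwards [hgs i his, Metric.isClosed_closedBall.isOpen_compl.mem_nhds hmem]
          with x hx hx'
        rw [hg'0 (hur hx'), hx]

/-- An orbit segment may revisit a point, which would prescribe two values there; since `I` has no
isolated points, the segment can be moved to distinct points. -/
lemma exists_injOn_dist_lt (x : ℕ → I) {r : ℝ} (hr : 0 < r) (p : ℕ) :
    ∃ y : ℕ → I, InjOn y (Finset.range p) ∧ ∀ i, dist (y i) (x i) < r := by
  induction p with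
  | zero => exact ⟨x, by simp, by simpa using hr⟩
  | succ p ih =>
    obtain ⟨y, hy, hyx⟩ := ih
    obtain ⟨z, hz, hzy⟩ := (infinite_of_mem_nhds (x p)
      (Metric.ball_mem_nhds (x p) hr)).exists_notMem_finset ((Finset.range p).image y)
    refine ⟨Function.update y p z, ?_, fun i => ?_⟩
    · have hne {i : ℕ} (hi : i < p) : y i ≠ z := fun h =>
        hzy (Finset.mem_image.2 ⟨i, Finset.mem_range.2 hi, h⟩)
      intro i hi j hj hij
      simp only [Finset.coe_range, mem_Iio] at hi hj
      rcases Nat.lt_succ_iff_lt_or_eq.1 hi with hi | rfl <;>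
      rcases Nat.lt_succ_iff_lt_or_eq.1 hj with hj | rfl
      · rw [Function.update_of_ne hi.ne, Function.update_of_ne hj.ne] at hij
        exact hy (by simpa using hi) (by simpa using hj) hij
      · rw [Function.update_of_ne hi.ne, Function.update_self] at hij
        exact absurd hij (hne hi)
      · rw [Function.update_of_ne hj.ne, Function.update_self] at hij
        exact absurd hij.symm (hne hj)
      · rfl
    · rcases eq_or_ne i p with rfl | hi
      · rw [Function.update_self]
        exact hz
      · rw [Function.update_of_ne hi]
        exact hyx i

/-- Closing: almost periodic orbits become periodic, and locally attracting, after a small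
perturbation of the map. -/
lemma exists_closing (f : C(I, I)) {η : ℝ} (hη : 0 < η) : ∃ δ > 0, ∀ x : I, ∀ p : ℕ, p ≠ 0 →
    dist (f^[p] x) x < δ → ∃ g : C(I, I), (∀ z, dist (g z) (f z) < η) ∧ ∃ y : ℕ → I,
      y p = y 0 ∧ (∀ j < p, ∀ᶠ z in 𝓝 (y j), g z = y (j + 1)) ∧
      ∀ j ≤ p, dist (y j) (f^[j] x) < η := by
  obtain ⟨ρ₀, hρ₀, hf⟩ := Metric.uniformContinuous_iff.1
    (CompactSpace.uniformContinuous_of_continuous f.continuous) (η / 2) (half_pos hη)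
  let ρ := min ρ₀ (η / 2)
  have hρ : 0 < ρ := lt_min hρ₀ (half_pos hη)
  refine ⟨ρ / 2, half_pos hρ, fun x p hp hx => ?_⟩
  obtain ⟨y₀, hinj, hy₀⟩ := exists_injOn_dist_lt (fun j => f^[j] x) (half_pos hρ) p
  -- The final point is replaced by the initial one; the return within `ρ / 2` keeps it `ρ`-close to
  -- `f^[p] x`.
  let y : ℕ → I := fun j => if j = p then y₀ 0 else y₀ j
  have hyp : y p = y₀ 0 := if_pos rfl
  have hyj {j : ℕ} (hj : j ≠ p) : y j = y₀ j := if_neg hj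
  have hdist (j : ℕ) : dist (y j) (f^[j] x) < ρ := by
    rcases eq_or_ne j p with rfl | hj
    · rw [hyp]
      refine (dist_triangle _ x _).trans_lt ?_
      rw [dist_comm x]
      exact (add_lt_add (hy₀ 0) hx).trans_eq (add_halves ρ)
    · rw [hyj hj]
      exact (hy₀ j).trans (half_lt_self hρ)
  have hstep : ∀ j ∈ Finset.range p, dist (y (j + 1)) (f (y j)) < η := by
    intro j _
    refine (dist_triangle _ (f^[j + 1] x) _).trans_lt ?_
    rw [← add_halves η]
    refine add_lt_add ((hdist _).trans_le (min_le_right _ _)) ?_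
    rw [Function.iterate_succ_apply', dist_comm]
    exact hf ((hdist j).trans_le (min_le_left _ _))
  have hinj' : InjOn y (Finset.range p) := hinj.congr fun j hj =>
    (hyj (Finset.mem_range.1 hj).ne).symm
  obtain ⟨g, hg, hgy⟩ := exists_eventually_eq_const f hη (Finset.range p) hinj' hstep
  refine ⟨g, hg, y, by rw [hyp, hyj hp.symm], fun j hj => hgy j (Finset.mem_range.2 hj),
    fun j _ => (hdist j).trans_le ((min_le_right _ _).trans (half_le_self hη.le))⟩

lemma mem_closure_mapsTrappingNear {ι : Type*} [Fintype ι] {φ : ι → C(I, ℝ)} {q : ι → ℝ} {κ : ℝ}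
    {f : C(I, I)} {μ : ProbabilityMeasure I} (hμ : Ergodic f (μ : Measure I))
    (hq : ∀ k, |∫ y, φ k y ∂(μ : Measure I) - q k| < κ) :
    f ∈ closure (mapsTrappingNear φ q κ) := by
  refine Metric.mem_closure_iff.2 fun η hη => ?_
  -- Two errors of size `τ` must fit: the orbit average against `μ`, and the perturbed average
  -- against the original.
  obtain ⟨τ, hτκ, hτ⟩ : ∃ τ : ℝ,
      (∀ k, |∫ y, φ k y ∂(μ : Measure I) - q k| + 2 * τ < κ) ∧ 0 < τ := by
    have hev : ∀ᶠ τ in 𝓝[>] (0 : ℝ), ∀ k, |∫ y, φ k y ∂(μ : Measure I) - q k| + 2 * τ < κ := by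
      refine eventually_all.2 fun k => mem_nhdsWithin_of_mem_nhds ?_
      have hcont : Continuous fun τ : ℝ => |∫ y, φ k y ∂(μ : Measure I) - q k| + 2 * τ := by
        fun_prop
      exact hcont.continuousAt.eventually (gt_mem_nhds (by simpa using hq k))
    exact (hev.and self_mem_nhdsWithin).exists
  have hunif : ∃ η' > 0, η' ≤ η ∧ ∀ k, ∀ a b : I, dist a b < η' → dist (φ k a) (φ k b) < τ := by
    have h (k : ι) := Metric.uniformContinuous_iff.1
      (CompactSpace.uniformContinuous_of_continuous (φ k).continuous) τ hτ
    choose r hr hφ using h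
    have hev : ∀ᶠ η' in 𝓝[>] (0 : ℝ), η' < η ∧ ∀ k, η' < r k :=
      mem_nhdsWithin_of_mem_nhds ((gt_mem_nhds hη).and
        (eventually_all.2 fun k => gt_mem_nhds (hr k)))
    obtain ⟨η', ⟨h1, h2⟩, h3⟩ := (hev.and self_mem_nhdsWithin).exists
    exact ⟨η', h3, h1.le, fun k a b hab => hφ k (hab.trans (h2 k))⟩
  obtain ⟨η', hη', hη'η, hφ⟩ := hunif
  obtain ⟨δ, hδ, hclose⟩ := exists_closing f hη'
  -- A point `c` of the support: its `δ / 2`-ball has positive measure, and a return to it is a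
  -- return within `δ`.
  obtain ⟨c, -, hc⟩ := exists_mem_forall_mem_nhdsWithin_pos_measure (μ := (μ : Measure I))
    (s := univ) (by simp)
  have hU0 := (hc _ (mem_nhdsWithin_of_mem_nhds (Metric.ball_mem_nhds c (half_pos hδ)))).ne'
  have hmem (k : ι) : MemLp (φ k ∘ f) 2 (μ : Measure I) :=
    .of_bound ((φ k).comp f).continuous.aestronglyMeasurable ‖φ k‖
      (.of_forall fun y => (φ k).norm_coe_le_norm (f y))
  obtain ⟨p, hp, x, hxU, hpU, havg⟩ := exists_return_birkhoffAverage hμ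
    Metric.isOpen_ball.measurableSet hU0 Finset.univ (fun k _ => hmem k) hτ
  have hret : dist (f^[p] x) x < δ := by
    have := dist_triangle_right (f^[p] x) x c
    rw [Metric.mem_ball] at hxU hpU
    linarith
  obtain ⟨g, hg, y, hyp, hgy, hyx⟩ := hclose x p hp hret
  refine ⟨g, ?_, (ContinuousMap.dist_lt_iff hη).2 fun z => ?_⟩
  swap
  · rw [dist_comm]
    exact (hg z).trans_le hη'η
  -- Near `y 0` the iterates of `g` up to time `p` are constant, so `g^[p]` collapses a small ball
  -- to its centre.
  have hiter (j : ℕ) (hj : j < p) : ∀ᶠ z in 𝓝 (y 0), g^[j + 1] z = y (j + 1) := by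
    induction j with
    | zero => exact hgy 0 hj
    | succ j ih =>
      filter_upwards [ih (by omega)] with z hz
      rw [Function.iterate_succ_apply', hz, (hgy (j + 1) hj).self_of_nhds]
  obtain ⟨r, hr, hball⟩ := Metric.nhds_basis_closedBall.mem_iff.1
    ((Finset.eventually_all (Finset.range p)).2 fun j hj => hiter j (Finset.mem_range.1 hj))
  refine ⟨p, hp, Metric.closedBall (y 0) r, isCompact_closedBall _ _, ⟨y 0, by simp [hr.le]⟩,
    fun z hz => ⟨?_, fun k => ?_⟩⟩
  · have h1 := hball hz (p - 1) (Finset.mem_range.2 (by omega))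
    rw [Nat.sub_add_cancel (Nat.pos_of_ne_zero hp), hyp] at h1
    rw [h1]
    exact Metric.ball_subset_interior_closedBall (Metric.mem_ball_self hr)
  · have hp0 : (0 : ℝ) < p := by exact_mod_cast Nat.pos_of_ne_zero hp
    have h1 : |birkhoffAverage ℝ g (φ k ∘ g) p z - birkhoffAverage ℝ f (φ k ∘ f) p x| ≤ τ := by
      have h2 : birkhoffAverage ℝ g (φ k ∘ g) p z - birkhoffAverage ℝ f (φ k ∘ f) p x =
          (p : ℝ)⁻¹ * ∑ j ∈ Finset.range p, (φ k (y (j + 1)) - φ k (f^[j + 1] x)) := by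
        rw [birkhoffAverage, birkhoffAverage, birkhoffSum, birkhoffSum, ← smul_sub,
          ← Finset.sum_sub_distrib, smul_eq_mul]
        congr 1
        refine Finset.sum_congr rfl fun j hj => ?_
        rw [Function.comp_apply, Function.comp_apply, ← Function.iterate_succ_apply' g,
          ← Function.iterate_succ_apply' f, hball hz j hj]
      rw [h2, abs_mul, abs_of_pos (inv_pos.2 hp0), inv_mul_le_iff₀ hp0]
      refine (Finset.abs_sum_le_sum_abs _ _).trans ?_
      refine (Finset.sum_le_sum fun j hj => (hφ k _ _
        (hyx (j + 1) (Finset.mem_range.1 hj))).le).trans_eq ?_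
      simp
    have h3 : |birkhoffAverage ℝ f (φ k ∘ f) p x - ∫ y, φ k y ∂(μ : Measure I)| < τ := by
      have := havg k (Finset.mem_univ k)
      have hmap := integral_map (μ := (μ : Measure I)) f.continuous.measurable.aemeasurable
        (φ k).continuous.aestronglyMeasurable
      rw [hμ.toMeasurePreserving.map_eq] at hmap
      rwa [hmap]
    have h4 := hτκ k
    have h5 := abs_sub_le (birkhoffAverage ℝ g (φ k ∘ g) p z)
      (birkhoffAverage ℝ f (φ k ∘ f) p x) (q k)
    have h6 := abs_sub_le (birkhoffAverage ℝ f (φ k ∘ f) p x)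
      (∫ y, φ k y ∂(μ : Measure I)) (q k)
    linarith

/-- An interval map has a fixed point `a`, and any `b ≠ a` close to it is almost fixed. A
perturbation fixes both and is constant near each, so small disjoint balls around them are trapping.
-/
lemma dense_mapsTwoTrapping : Dense (mapsTwoTrapping I) := by
  refine Metric.dense_iff.2 fun f η hη => ?_
  obtain ⟨a, -, ha⟩ := exists_mem_Icc_isFixedPt_of_mapsTo (f := f) (a := 0) (b := 1)
    f.continuous.continuousOn zero_le_one fun x _ => ⟨(f x).2.1, (f x).2.2⟩
  have hev : ∀ᶠ b in 𝓝[≠] a, dist b (f b) < η := by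
    refine mem_nhdsWithin_of_mem_nhds
      ((continuous_id.dist f.continuous).continuousAt.eventually (gt_mem_nhds ?_))
    change dist a (f a) < η
    rwa [ha, dist_self]
  obtain ⟨b, hb, hba⟩ := (hev.and eventually_mem_nhdsWithin).exists
  obtain ⟨g, hg, hgs⟩ := exists_eventually_eq_const f hη ({a, b} : Finset I) (y := id) (t := id)
    (injOn_id _) (by
      intro i hi
      rcases Finset.mem_insert.1 hi with rfl | hi
      · change dist i (f i) < η
        rwa [ha, dist_self]
      · rw [Finset.mem_singleton.1 hi]
        exact hb)
  refine ⟨g, (ContinuousMap.dist_lt_iff hη).2 hg, ?_⟩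
  have hab : 0 < dist a b / 2 := half_pos (dist_pos.2 (Ne.symm hba))
  have htrap (c : I) (hc : ∀ᶠ x in 𝓝 c, g x = c) : ∃ r > 0,
      Metric.closedBall c r ⊆ Metric.ball c (dist a b / 2) ∧
      MapsTo g (Metric.closedBall c r) (interior (Metric.closedBall c r)) := by
    obtain ⟨r, hr, hball⟩ := Metric.nhds_basis_closedBall.mem_iff.1
      (inter_mem hc (Metric.ball_mem_nhds c hab))
    refine ⟨r, hr, fun x hx => (hball hx).2, fun x hx => ?_⟩
    rw [show g x = c from (hball hx).1]
    exact Metric.ball_subset_interior_closedBall (Metric.mem_ball_self hr)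
  obtain ⟨r, hr, hsub, hmaps⟩ := htrap a (hgs a (by simp))
  obtain ⟨r', hr', hsub', hmaps'⟩ := htrap b (hgs b (by simp))
  exact ⟨_, _, isCompact_closedBall a r, isCompact_closedBall b r',
    ⟨a, Metric.mem_closedBall_self hr.le⟩, ⟨b, Metric.mem_closedBall_self hr'.le⟩,
    (Metric.ball_disjoint_ball (add_halves _).le).mono hsub hsub', hmaps, hmaps'⟩

end Perturbation

/-! ### Genericity and conclusion -/

/-- For generic maps of the interval, every ergodic measure is pseudo-physical. -/
theorem eventually_residual_ergodic_mem_pseudoPhysicalMeasures :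
    ∀ᶠ f : C(I, I) in residual C(I, I), ∀ μ : ProbabilityMeasure I, Ergodic f (μ : Measure I) →
      μ ∈ pseudoPhysicalMeasures f := by
  let φ : ℕ → C(I, ℝ) := TopologicalSpace.denseSeq C(I, ℝ)
  have hφ : DenseRange φ := TopologicalSpace.denseRange_denseSeq _
  let W : (N : ℕ) → (Fin N → ℚ) → Set C(I, I) := fun N q =>
    mapsTrappingNear (fun k : Fin N => φ k) (fun k => (q k : ℝ)) ((N : ℝ) + 1)⁻¹
  have hres : ∀ᶠ f : C(I, I) in residual C(I, I), ∀ N, ∀ q : Fin N → ℚ,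
      f ∈ closure (W N q) → f ∈ W N q := by
    refine eventually_countable_forall.2 fun N => eventually_countable_forall.2 fun q => ?_
    have hopen : IsOpen (W N q) := isOpen_mapsTrappingNear _ _ _
    -- Density of `W N q` is not available; a generic map avoids only the boundary of each of these
    -- countably many open sets, so lying in the closure implies lying in the set.
    have hdense : Dense (W N q ∪ (closure (W N q))ᶜ) := by
      intro f
      by_cases hf : f ∈ closure (W N q)
      · exact closure_mono subset_union_left hf
      · exact subset_closure (Or.inr hf)
    filter_upwards [residual_of_dense_open (hopen.union isClosed_closure.isOpen_compl) hdense]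
      with f hf hf'
    exact hf.resolve_right fun h => h hf'
  filter_upwards [hres] with f hf μ hμ
  refine mem_of_forall_exists_abs_integral_sub_le hφ (isClosed_pseudoPhysicalMeasures f) (C := 2)
    fun N => ?_
  have hN : (0 : ℝ) < ((N : ℝ) + 1)⁻¹ := by positivity
  have hq (k : Fin N) : ∃ q : ℚ, |∫ y, φ k y ∂(μ : Measure I) - q| < ((N : ℝ) + 1)⁻¹ :=
    exists_rat_near _ hN
  choose q hq using hq
  obtain ⟨ν, hν, hνq⟩ := exists_pseudoPhysicalMeasure_of_mem_mapsTrappingNear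
    (hf N q (mem_closure_mapsTrappingNear hμ hq))
  refine ⟨ν, hν, fun k hk => ?_⟩
  have h1 := hνq ⟨k, hk⟩
  have h2 := hq ⟨k, hk⟩
  rw [abs_sub_comm] at h2
  refine (abs_sub_le _ (q ⟨k, hk⟩ : ℝ) _).trans ?_
  rw [two_mul]
  exact add_le_add h1 h2.le

end EmpiricStability

theorem mainTheorem10 :
    ∀ᶠ f : C(I, I) in residual C(I, I),
      ∀ d : ProbabilityMeasure I → ProbabilityMeasure I → ℝ,
        EmpiricStability.IsWeakStarMetric d →
        ∃ K : Set (ProbabilityMeasure I),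
          EmpiricStability.IsGloballyEmpiricallyStable d f K ∧
          (∀ K' : Set (ProbabilityMeasure I),
            EmpiricStability.IsGloballyEmpiricallyStable d f K' → K' = K) ∧
          (∀ μ : ProbabilityMeasure I, Ergodic f (μ : Measure I) → μ ∈ K) ∧
          IsClosed {μ : EmpiricStability.invariantMeasures f | (μ : ProbabilityMeasure I) ∈ K} ∧
          interior {μ : EmpiricStability.invariantMeasures f |
            (μ : ProbabilityMeasure I) ∈ K} = ∅ ∧
          IsMeagre {μ : EmpiricStability.invariantMeasures f |
            (μ : ProbabilityMeasure I) ∈ K} := by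
  -- Neither generic condition involves `d`, so one residual set serves all metrics.
  filter_upwards [EmpiricStability.eventually_residual_ergodic_mem_pseudoPhysicalMeasures,
    residual_of_dense_open EmpiricStability.isOpen_mapsTwoTrapping
      EmpiricStability.dense_mapsTwoTrapping] with f herg htwo d hd
  have hclosed : IsClosed {μ : EmpiricStability.invariantMeasures f |
      (μ : ProbabilityMeasure I) ∈ EmpiricStability.pseudoPhysicalMeasures f} :=
    (EmpiricStability.isClosed_pseudoPhysicalMeasures f).preimage continuous_subtype_val
  have hint := EmpiricStability.interior_pseudoPhysicalMeasures_eq_empty htwo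
  exact ⟨EmpiricStability.pseudoPhysicalMeasures f,
    hd.isGloballyEmpiricallyStable (NeZero.ne volume) f,
    fun K' hK' => hd.eq_pseudoPhysicalMeasures hK', herg, hclosed, hint,
    (hclosed.isNowhereDense_iff.2 hint).isMeagre⟩
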